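/- For a matrix $Z=[z_{ij}]_{i,j=0}^2\in M_3(\mathbb C)$ and real numbers $m,n$ let $$\Psi_{m,n}(Z)=B_{m,n}(Z)+b\begin{bmatrix} z_{11}&0&-z_{02}\\0&z_{22}&-z_{12}\\-z_{20}&-z_{21}&z_{00}+z_{22}\end{bmatrix}+c\begin{bmatrix}0&z_{01}-z_{10}&0\\z_{10}-z_{01}&0&0\\0&0&0\end{bmatrix},$$ where $B_{m,n}(Z)$ is the $3\times 3$ matrix with entries $$\begin{aligned} B_{00}&=n^2\bigl(z_{00}+m(z_{01}+z_{10})+m^2z_{11}\bigr), & B_{01}&=-mn\,(n z_{00}-z_{01}+mn z_{10}-m z_{11}), & B_{02}&=-n(m+n)(z_{02}+m z_{12}),\\ B_{10}&=-mn\,(n z_{00}-z_{10}+mn z_{01}-m z_{11}), & B_{11}&=m^2\bigl(n^2z_{00}-n(z_{01}+z_{10})+z_{11}\bigr), & B_{12}&=m(m+n)(n z_{02}-z_{12}),\\ B_{20}&=-n(m+n)(z_{20}+m z_{21}), & B_{21}&=m(m+n)(n z_{20}-z_{21}), & B_{22}&=(m+n)^2z_{22}, \end{aligned}$$ and $$b=\min\{-2mn-m^2n^2-n^2,\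 -2mn-m^2n^2-m^2\},$$ $$c=\max\Bigl\{-\tfrac12 mn\bigl(1+mn-\sqrt{1-n^2}\bigr),\ -\tfrac12 mn\bigl(1+mn-\sqrt{1-m^2}\bigr)\Bigr\}.$$ Let $\mathcal A=\{(m,n)\in[-1,1]^2:\ -2mn-m^2n^2-n^2\ge 0,\ -2mn-m^2n^2-m^2\ge 0\}$, with topological boundary $\partial\mathcal A$ in $\mathbb R^2$. A linear map $\Phi:M_3(\mathbb C)\to M_3(\mathbb C)$ is *positive* if it maps positive semidefinite matrices to positive semidefinite matrices, *completely positive* if $\Phi\otimes\mathrm{Id}_{M_k}$ is positive for every $k$, and *co-completely positive* if $T\circ\Phi$ is completely positive, where $T$ is the transposition. A positive map $\Phi\neq0$ is *extreme* if it spans an extreme ray of the cone of positive maps, that is, whenever $\Phi=\Phi_1+\Phi_2$ with $\Phi_1,\Phi_2$ positive, both $\Phi_1$ and $\Phi_2$ are nonnegative multiples of $\Phi$. The *Kraus rank* of a completely positive map is the least $K$ such that $\Phi(Z)=\sum_{k=1}^K A_kZA_k^\dagger$ for some matrices $A_k$. **Theorem.** Let $(m,n)\in\mathcal A$. Then: 1.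 $\Psi_{m,n}$ is a positive map. If $(m,n)\ne(0,0)$ it is an extreme positive map (in particular nonzero), while $\Psi_{0,0}=0$. 2. If $(m,n)\notin\partial\mathcal A$, then $\Psi_{m,n}$ is neither completely positive nor co-completely positive. 3. If $(m,n)\in\partial\mathcal A$, then $\Psi_{m,n}$ is completely positive, and it has Kraus rank $1$ if moreover $(m,n)\neq(0,0)$. -/

import Mathlib

open Matrix
open scoped ComplexOrder Kronecker

/-- A quantum map (superoperator) from `d₂ × d₂` to `d₁ × d₁` complex matrices.  Positivity forces
such a map to preserve self-adjointness, and self-adjointness-preserving `ℂ`-linear maps correspond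
to `ℝ`-linear maps between the spaces of self-adjoint matrices by restriction. -/
abbrev QMap (d₂ d₁ : ℕ) : Type :=
  Matrix (Fin d₂) (Fin d₂) ℂ →ₗ[ℂ] Matrix (Fin d₁) (Fin d₁) ℂ

namespace QMap

variable {d₁ d₂ : ℕ}

/-- `Φ` is positive: it maps positive semidefinite matrices to positive semidefinite matrices. -/
def IsPositive (Φ : QMap d₂ d₁) : Prop :=
  ∀ Z : Matrix (Fin d₂) (Fin d₂) ℂ, Z.PosSemidef → (Φ Z).PosSemidef

/-- The map `Φ ⊗ Id_k` on block matrices, where `k × k` is the size of the second tensor factor. -/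
def ampliation (Φ : QMap d₂ d₁) (k : ℕ) (Z : Matrix (Fin d₂ × Fin k) (Fin d₂ × Fin k) ℂ) :
    Matrix (Fin d₁ × Fin k) (Fin d₁ × Fin k) ℂ :=
  Matrix.of fun p q => Φ (Matrix.of fun i j => Z (i, p.2) (j, q.2)) p.1 q.1

theorem ampliation_kronecker (Φ : QMap d₂ d₁) (k : ℕ) (A : Matrix (Fin d₂) (Fin d₂) ℂ)
    (B : Matrix (Fin k) (Fin k) ℂ) : Φ.ampliation k (A ⊗ₖ B) = Φ A ⊗ₖ B := by
  ext p q
  have h : (Matrix.of fun i j => (A ⊗ₖ B) (i, p.2) (j, q.2)) = B p.2 q.2 • A := by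
    ext i j
    simp [Matrix.kroneckerMap_apply, mul_comm]
  rw [ampliation, Matrix.of_apply, h, map_smul, Matrix.smul_apply, smul_eq_mul,
    Matrix.kroneckerMap_apply, mul_comm]

/-- `Φ` is completely positive: `Φ ⊗ Id_k` is positive for every `k`. -/
def IsCompletelyPositive (Φ : QMap d₂ d₁) : Prop :=
  ∀ (k : ℕ) (Z : Matrix (Fin d₂ × Fin k) (Fin d₂ × Fin k) ℂ),
    Z.PosSemidef → (Φ.ampliation k Z).PosSemidef

/-- The map `T ∘ Φ`, where `T` is the transposition. -/
def transposeComp (Φ : QMap d₂ d₁) : QMap d₂ d₁ :=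
  (Matrix.transposeLinearEquiv (Fin d₁) (Fin d₁) ℂ ℂ).toLinearMap ∘ₗ Φ

/-- `Φ` is co-completely positive: `T ∘ Φ` is completely positive. -/
def IsCoCompletelyPositive (Φ : QMap d₂ d₁) : Prop :=
  Φ.transposeComp.IsCompletelyPositive

/-- `Φ` is an extreme positive map: it is nonzero and spans an extreme ray of the cone of positive
maps, i.e. both summands of any decomposition of `Φ` into a sum of two positive maps are
nonnegative multiples of `Φ`. -/
def IsExtremePositive (Φ : QMap d₂ d₁) : Prop :=
  Φ.IsPositive ∧ Φ ≠ 0 ∧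
    ∀ Φ₁ Φ₂ : QMap d₂ d₁, Φ₁.IsPositive → Φ₂.IsPositive → Φ₁ + Φ₂ = Φ →
      ∃ s t : ℝ, 0 ≤ s ∧ 0 ≤ t ∧ Φ₁ = (s : ℂ) • Φ ∧ Φ₂ = (t : ℂ) • Φ

/-- `Φ` has a Kraus decomposition `Φ Z = ∑ k, A k * Z * (A k)ᴴ` with `K` terms. -/
def HasKrausDecomposition (Φ : QMap d₂ d₁) (K : ℕ) : Prop :=
  ∃ A : Fin K → Matrix (Fin d₁) (Fin d₂) ℂ, ∀ Z, Φ Z = ∑ k, A k * Z * (A k)ᴴ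

/-- The Kraus rank of `Φ` is `r`: the least number of terms in a Kraus decomposition is `r`. -/
def HasKrausRank (Φ : QMap d₂ d₁) (r : ℕ) : Prop :=
  IsLeast {K : ℕ | Φ.HasKrausDecomposition K} r

end QMap

/-- The double leaf `𝒜 ⊆ [-1,1]²`. -/
def doubleLeaf : Set (ℝ × ℝ) :=
  {p | p.1 ∈ Set.Icc (-1) 1 ∧ p.2 ∈ Set.Icc (-1) 1 ∧
    0 ≤ -2 * p.1 * p.2 - p.1 ^ 2 * p.2 ^ 2 - p.2 ^ 2 ∧
    0 ≤ -2 * p.1 * p.2 - p.1 ^ 2 * p.2 ^ 2 - p.1 ^ 2}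

/-- The coefficient `b`. -/
noncomputable def psiB (m n : ℝ) : ℝ :=
  min (-2 * m * n - m ^ 2 * n ^ 2 - n ^ 2) (-2 * m * n - m ^ 2 * n ^ 2 - m ^ 2)

/-- The coefficient `c`. -/
noncomputable def psiC (m n : ℝ) : ℝ :=
  max (-(1 / 2) * (m * n) * (1 + m * n - √(1 - n ^ 2)))
    (-(1 / 2) * (m * n) * (1 + m * n - √(1 - m ^ 2)))

/-- The base part of `Ψ_{m,n}`. -/
def psiBase (m n : ℂ) (z : Matrix (Fin 3) (Fin 3) ℂ) : Matrix (Fin 3) (Fin 3) ℂ :=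
  !![n ^ 2 * (z 0 0 + m * (z 0 1 + z 1 0) + m ^ 2 * z 1 1),
      -(m * n) * (n * z 0 0 - z 0 1 + m * n * z 1 0 - m * z 1 1),
      -n * (m + n) * (z 0 2 + m * z 1 2);
    -(m * n) * (n * z 0 0 - z 1 0 + m * n * z 0 1 - m * z 1 1),
      m ^ 2 * (n ^ 2 * z 0 0 - n * (z 0 1 + z 1 0) + z 1 1),
      m * (m + n) * (n * z 0 2 - z 1 2);
    -n * (m + n) * (z 2 0 + m * z 2 1),
      m * (m + n) * (n * z 2 0 - z 2 1),
      (m + n) ^ 2 * z 2 2]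

/-- The Choi-type part of `Ψ_{m,n}`. -/
def psiChoi (z : Matrix (Fin 3) (Fin 3) ℂ) : Matrix (Fin 3) (Fin 3) ℂ :=
  !![z 1 1, 0, -z 0 2;
    0, z 2 2, -z 1 2;
    -z 2 0, -z 2 1, z 0 0 + z 2 2]

/-- The antisymmetric part of `Ψ_{m,n}`. -/
def psiAnti (z : Matrix (Fin 3) (Fin 3) ℂ) : Matrix (Fin 3) (Fin 3) ℂ :=
  !![0, z 0 1 - z 1 0, 0;
    z 1 0 - z 0 1, 0, 0;
    0, 0, 0]

/-- The quantum map `Ψ_{m,n}`. -/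
noncomputable def psi (m n : ℝ) : QMap 3 3 where
  toFun z := psiBase m n z + (psiB m n : ℂ) • psiChoi z + (psiC m n : ℂ) • psiAnti z
  map_add' x y := by
    ext i j
    fin_cases i <;> fin_cases j <;> simp [psiBase, psiChoi, psiAnti] <;> ring
  map_smul' a x := by
    ext i j
    fin_cases i <;> fin_cases j <;> simp [psiBase, psiChoi, psiAnti] <;> ring

/-! Write b, c for `psiB`, `psiC`. Everything is read off the biquadratic form y†Φ(xx†)y, whose
nonnegativity is equivalent to positivity of Φ. Exchanging x and y and swapping the first two
coordinates turns the form of Ψ_{m,n} into that of Ψ_{n,m} (`swapDual_psi`), so m² ≤ n² may be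
assumed. Then, with s = √(1-n²), b = s² - (1+mn)² and c = mn(s-1-mn)/2, hence 4c(mn(1+mn)+c) =
b(mn)². This quadratic relation drives the positivity computation.

Positivity. The frontier of the double leaf is b = 0; there c = 0 and Ψ is z ↦ VzV†. If b > 0, it
suffices by scaling and continuity to take x = (1,z,w) with w ≠ 0. The first two leading minors of
Ψ(xx†) are then positive (`psi_minor_pos`), and the determinant is a sum of two nonnegative parts,
one free of c (`det_main_part_nonneg`) and one carrying the factor (Im z)²
(`det_imaginary_part_nonneg`).

Extremality. A positive summand of Ψ vanishes at every zero of its form, and a nonnegative form has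
vanishing first derivatives at a zero. The form of Ψ has two isolated basis zeros, the circles x = y
= (1,±1,w), and a curve. The resulting linear equations leave only the multiples of Ψ
(`QMap.eq_zero_of_nullAt`). At the cusps n² = 1 the curve degenerates, but there Ψ has a rank-one
Kraus operator and its zeros fill hyperplanes.

If b > 0, explicit vectors make the Choi form of Ψ, and that of its transpose, negative. -/

theorem Matrix.posSemidef_of_dotProduct_nonneg {n : Type*} [Fintype n] [DecidableEq n]
    {A : Matrix n n ℂ} (h : ∀ x : n → ℂ, 0 ≤ star x ⬝ᵥ A *ᵥ x) : A.PosSemidef := by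
  refine PosSemidef.of_dotProduct_mulVec_nonneg ?_ h
  rw [← isSymmetric_toEuclideanLin_iff, LinearMap.isSymmetric_iff_inner_map_self_real]
  intro v
  have h1 := h v.ofLp
  have h2 : inner ℂ (toEuclideanLin A v) v = star (star v.ofLp ⬝ᵥ A *ᵥ v.ofLp) := by
    rw [← inner_conj_symm, EuclideanSpace.inner_eq_star_dotProduct, dotProduct_comm]
    rfl
  rw [h2]
  have h3 : star (star v.ofLp ⬝ᵥ A *ᵥ v.ofLp) = star v.ofLp ⬝ᵥ A *ᵥ v.ofLp :=
    Complex.conj_eq_iff_im.2 (Complex.nonneg_iff.1 h1).2.symm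
  simp only [starRingEnd_apply, h3]

/-! ### Biquadratic forms, first-order conditions at zeros, swap duality -/

namespace QMap

variable {d₁ d₂ : ℕ}

/-- The biquadratic form `y† Φ(x x†) y`. -/
noncomputable def form (Φ : QMap d₂ d₁) (x : Fin d₂ → ℂ) (y : Fin d₁ → ℂ) : ℂ :=
  star y ⬝ᵥ Φ (vecMulVec x (star x)) *ᵥ y

theorem form_add (Φ Ψ : QMap d₂ d₁) (x : Fin d₂ → ℂ) (y : Fin d₁ → ℂ) :
    (Φ + Ψ).form x y = Φ.form x y + Ψ.form x y := by
  simp [form, add_mulVec]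

theorem isPositive_iff_form_nonneg (Φ : QMap d₂ d₁) :
    Φ.IsPositive ↔ ∀ x y, 0 ≤ Φ.form x y := by
  constructor
  · intro h x y
    exact (h _ (posSemidef_vecMulVec_self_star x)).dotProduct_mulVec_nonneg y
  · intro h Z hZ
    obtain ⟨m, v, rfl⟩ := posSemidef_iff_eq_sum_vecMulVec.1 hZ
    rw [map_sum]
    exact posSemidef_sum _ fun i _ => posSemidef_of_dotProduct_nonneg fun y => h (v i) y

/-- The entries of the images of the matrix units. -/
noncomputable def tensor (Φ : QMap d₂ d₁) (i j : Fin d₂) (k l : Fin d₁) : ℂ :=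
  Φ (single i j 1) k l

theorem apply_eq_sum_tensor (Φ : QMap d₂ d₁) (Z : Matrix (Fin d₂) (Fin d₂) ℂ) (k l : Fin d₁) :
    Φ Z k l = ∑ i, ∑ j, Z i j * Φ.tensor i j k l := by
  conv_lhs => rw [matrix_eq_sum_single Z]
  simp only [map_sum, Matrix.sum_apply, tensor]
  refine Finset.sum_congr rfl fun i _ => Finset.sum_congr rfl fun j _ => ?_
  rw [show single i j (Z i j) = Z i j • single i j (1 : ℂ) by simp [smul_single], map_smul]
  rfl

theorem ext_tensor {Φ Ψ : QMap d₂ d₁} (h : ∀ i j k l, Φ.tensor i j k l = Ψ.tensor i j k l) :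
    Φ = Ψ := by
  ext1 Z
  ext k l
  simp only [apply_eq_sum_tensor, h]

theorem tensor_sub_smul (Φ Ψ : QMap d₂ d₁) (a : ℂ) (i j : Fin d₂) (k l : Fin d₁) :
    (Φ - a • Ψ).tensor i j k l = Φ.tensor i j k l - a * Ψ.tensor i j k l := by
  simp [tensor]

/-- All first-order conditions satisfied by a nonnegative form `Φ.form` at a zero `(x, y)`. -/
structure NullAt (Φ : QMap d₂ d₁) (x : Fin d₂ → ℂ) (y : Fin d₁ → ℂ) : Prop where
  output_right : ∀ k, ∑ i, ∑ j, ∑ l, x i * star (x j) * y l * Φ.tensor i j k l = 0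
  output_left : ∀ l, ∑ i, ∑ j, ∑ k, x i * star (x j) * star (y k) * Φ.tensor i j k l = 0
  input_right : ∀ j, ∑ i, ∑ k, ∑ l, x i * star (y k) * y l * Φ.tensor i j k l = 0
  input_left : ∀ i, ∑ j, ∑ k, ∑ l, star (x j) * star (y k) * y l * Φ.tensor i j k l = 0

theorem NullAt.sub_smul {Φ Ψ : QMap d₂ d₁} {x : Fin d₂ → ℂ} {y : Fin d₁ → ℂ}
    (h : Φ.NullAt x y) (h' : Ψ.NullAt x y) (a : ℂ) : (Φ - a • Ψ).NullAt x y := by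
  have key : ∀ c u v : ℂ, c * (u - a * v) = c * u - a * (c * v) := fun c u v => by ring
  constructor <;> intro t <;>
    simp only [tensor_sub_smul, key, Finset.sum_sub_distrib, ← Finset.mul_sum]
  · rw [h.output_right, h'.output_right]; simp
  · rw [h.output_left, h'.output_left]; simp
  · rw [h.input_right, h'.input_right]; simp
  · rw [h.input_left, h'.input_left]; simp

theorem _root_.Finset.sum_comm_pairs {α β γ δ M : Type*} [AddCommMonoid M] [Fintype α] [Fintype β]
    [Fintype γ] [Fintype δ] (f : α → β → γ → δ → M) :
    ∑ a, ∑ b, ∑ c, ∑ d, f a b c d = ∑ c, ∑ d, ∑ a, ∑ b, f a b c d := by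
  calc ∑ a, ∑ b, ∑ c, ∑ d, f a b c d
      = ∑ p : α × β, ∑ q : γ × δ, f p.1 p.2 q.1 q.2 := by simp only [Fintype.sum_prod_type]
    _ = ∑ q : γ × δ, ∑ p : α × β, f p.1 p.2 q.1 q.2 := Finset.sum_comm
    _ = _ := by simp only [Fintype.sum_prod_type]

theorem form_eq_sum (Φ : QMap d₂ d₁) (x : Fin d₂ → ℂ) (y : Fin d₁ → ℂ) :
    Φ.form x y =
      ∑ i, ∑ j, ∑ k, ∑ l, x i * star (x j) * star (y k) * y l * Φ.tensor i j k l := by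
  rw [Finset.sum_comm_pairs]
  simp only [form, dotProduct, mulVec, apply_eq_sum_tensor, Finset.mul_sum, Finset.sum_mul,
    vecMulVec_apply, Pi.star_apply]
  refine Finset.sum_congr rfl fun k _ => Finset.sum_congr rfl fun l _ =>
    Finset.sum_congr rfl fun i _ => Finset.sum_congr rfl fun j _ => ?_
  ring

theorem _root_.Matrix.PosSemidef.sum_eq_zero {n : Type*} [Fintype n] {A : Matrix n n ℂ}
    (hA : A.PosSemidef) {y : n → ℂ} (h : star y ⬝ᵥ A *ᵥ y = 0) :
    (∀ k, ∑ l, A k l * y l = 0) ∧ ∀ l, ∑ k, star (y k) * A k l = 0 := by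
  have h1 : A *ᵥ y = 0 := (hA.dotProduct_mulVec_zero_iff y).1 h
  have h2 : star y ᵥ* A = 0 := by
    have := congrArg star h1
    rwa [star_mulVec, hA.isHermitian.eq, star_zero] at this
  exact ⟨fun k => congrFun h1 k, fun l => congrFun h2 l⟩

/-- For fixed x the form is a positive semidefinite Hermitian form in y, and for fixed y one in x
(with matrix `B`). A vector on which such a form vanishes lies in the kernel, on the left and on the
right. Keeping both sides makes all later conditions ℂ-linear in the tensor. -/
theorem IsPositive.nullAt {Φ : QMap d₂ d₁} (hΦ : Φ.IsPositive) {x : Fin d₂ → ℂ}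
    {y : Fin d₁ → ℂ} (h : Φ.form x y = 0) : Φ.NullAt x y := by
  have hA : (Φ (vecMulVec x (star x))).PosSemidef := hΦ _ (posSemidef_vecMulVec_self_star x)
  let B : Matrix (Fin d₂) (Fin d₂) ℂ :=
    of fun j i => ∑ k, ∑ l, star (y k) * y l * Φ.tensor i j k l
  have hBform : ∀ v : Fin d₂ → ℂ, star v ⬝ᵥ B *ᵥ v = Φ.form v y := by
    intro v
    rw [form_eq_sum, Finset.sum_comm]
    simp only [dotProduct, mulVec, Finset.mul_sum, Finset.sum_mul, B, of_apply, Pi.star_apply]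
    refine Finset.sum_congr rfl fun j _ => Finset.sum_congr rfl fun i _ =>
      Finset.sum_congr rfl fun k _ => Finset.sum_congr rfl fun l _ => ?_
    ring
  have hB : B.PosSemidef := posSemidef_of_dotProduct_nonneg fun v => by
    rw [hBform]
    exact (isPositive_iff_form_nonneg Φ).1 hΦ v y
  obtain ⟨h1, h2⟩ := hA.sum_eq_zero h
  obtain ⟨h3, h4⟩ := hB.sum_eq_zero ((hBform x).trans h)
  constructor
  · intro k
    rw [← h1 k]
    simp only [apply_eq_sum_tensor, Finset.sum_mul, vecMulVec_apply, Pi.star_apply]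
    refine ((Finset.sum_congr rfl fun i _ => Finset.sum_comm).trans Finset.sum_comm).trans ?_
    refine Finset.sum_congr rfl fun l _ => Finset.sum_congr rfl fun i _ =>
      Finset.sum_congr rfl fun j _ => ?_
    ring
  · intro l
    rw [← h2 l]
    simp only [apply_eq_sum_tensor, Finset.mul_sum, vecMulVec_apply, Pi.star_apply]
    refine ((Finset.sum_congr rfl fun i _ => Finset.sum_comm).trans Finset.sum_comm).trans ?_
    refine Finset.sum_congr rfl fun k _ => Finset.sum_congr rfl fun i _ =>
      Finset.sum_congr rfl fun j _ => ?_
    ring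
  · intro j
    rw [← h3 j]
    simp only [B, of_apply, Finset.sum_mul]
    refine Finset.sum_congr rfl fun i _ => Finset.sum_congr rfl fun k _ =>
      Finset.sum_congr rfl fun l _ => ?_
    ring
  · intro i
    rw [← h4 i]
    simp only [B, of_apply, Finset.mul_sum]
    refine Finset.sum_congr rfl fun j _ => Finset.sum_congr rfl fun k _ =>
      Finset.sum_congr rfl fun l _ => ?_
    ring

theorem IsPositive.form_eq_zero_of_add {Φ Ψ : QMap d₂ d₁} (hΦ : Φ.IsPositive)
    (hΨ : Ψ.IsPositive) {x : Fin d₂ → ℂ} {y : Fin d₁ → ℂ} (h : (Φ + Ψ).form x y = 0) :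
    Φ.form x y = 0 ∧ Ψ.form x y = 0 := by
  rw [form_add] at h
  exact (add_eq_zero_iff_of_nonneg ((isPositive_iff_form_nonneg Φ).1 hΦ x y)
    ((isPositive_iff_form_nonneg Ψ).1 hΨ x y)).1 h

theorem IsPositive.tensor_nonneg {Φ : QMap d₂ d₁} (hΦ : Φ.IsPositive) (i : Fin d₂)
    (k : Fin d₁) : 0 ≤ Φ.tensor i i k k := by
  refine (hΦ (single i i 1) ?_).diag_nonneg
  have := posSemidef_vecMulVec_self_star (Pi.single i (1 : ℂ))
  convert this using 1
  ext a c
  simp [vecMulVec_apply, single_apply, Pi.single_apply]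
  grind

/-- A positive map is extreme if it is determined up to a factor by the first-order conditions
at a set of zeros of its form. -/
theorem isExtremePositive_of_nullAt {Φ : QMap d₂ d₁} (hΦ : Φ.IsPositive) {i₀ : Fin d₂}
    {k₀ : Fin d₁} (h₀ : Φ.tensor i₀ i₀ k₀ k₀ ≠ 0)
    (h : ∀ D : QMap d₂ d₁, (∀ x y, Φ.form x y = 0 → D.NullAt x y) →
      D.tensor i₀ i₀ k₀ k₀ = 0 → D = 0) : Φ.IsExtremePositive := by
  refine ⟨hΦ, fun h0 => h₀ (by simp [h0, tensor]), ?_⟩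
  have key : ∀ Φ₁ : QMap d₂ d₁, Φ₁.IsPositive → (∀ x y, Φ.form x y = 0 → Φ₁.form x y = 0) →
      ∃ s : ℝ, 0 ≤ s ∧ Φ₁ = (s : ℂ) • Φ := by
    intro Φ₁ h₁ hz
    set a := Φ₁.tensor i₀ i₀ k₀ k₀ with ha
    set b := Φ.tensor i₀ i₀ k₀ k₀ with hb
    have ha' := Complex.nonneg_iff.1 (h₁.tensor_nonneg i₀ k₀)
    have hb' := Complex.nonneg_iff.1 (hΦ.tensor_nonneg i₀ k₀)
    have hab : ((a.re / b.re : ℝ) : ℂ) = a / b := by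
      rw [Complex.ofReal_div]
      congr 1
      · exact Complex.ext rfl ha'.2
      · exact Complex.ext rfl hb'.2
    refine ⟨a.re / b.re, div_nonneg ha'.1 hb'.1, ?_⟩
    -- The multiple of `Φ` is chosen so that the difference has zero reference entry; the difference
    -- inherits the first-order conditions by linearity.
    rw [hab, ← sub_eq_zero]
    refine h _ (fun x y hxy => (h₁.nullAt (hz x y hxy)).sub_smul (hΦ.nullAt hxy) _) ?_
    rw [tensor_sub_smul, ← ha, ← hb, div_mul_cancel₀ _ h₀, sub_self]
  intro Φ₁ Φ₂ h₁ h₂ hadd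
  obtain ⟨s, hs, hs'⟩ := key Φ₁ h₁ fun x y hxy => (h₁.form_eq_zero_of_add h₂ (hadd ▸ hxy)).1
  obtain ⟨t, ht, ht'⟩ := key Φ₂ h₂ fun x y hxy => (h₁.form_eq_zero_of_add h₂ (hadd ▸ hxy)).2
  exact ⟨s, t, hs, ht, hs', ht'⟩

/-- The dual map with respect to the trace pairing, with the first two basis vectors swapped. -/
noncomputable def swapDual (Φ : QMap 3 3) : QMap 3 3 where
  toFun Z := of fun k l => ∑ i, ∑ j, Z i j *
    Φ.tensor (Equiv.swap 0 1 l) (Equiv.swap 0 1 k) (Equiv.swap 0 1 j) (Equiv.swap 0 1 i)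
  map_add' Z W := by
    ext k l
    simp [add_mul, Finset.sum_add_distrib]
  map_smul' a Z := by
    ext k l
    simp [Finset.mul_sum, mul_assoc]

theorem tensor_swapDual (Φ : QMap 3 3) (i j k l : Fin 3) :
    Φ.swapDual.tensor i j k l =
      Φ.tensor (Equiv.swap 0 1 l) (Equiv.swap 0 1 k) (Equiv.swap 0 1 j) (Equiv.swap 0 1 i) := by
  simp only [tensor, swapDual, LinearMap.coe_mk, AddHom.coe_mk, of_apply]
  rw [Finset.sum_eq_single i, Finset.sum_eq_single j]
  · simp
  · intro b _ hb
    simp [hb.symm]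
  · simp
  · intro b _ hb
    simp [hb.symm]
  · simp

theorem swapDual_swapDual (Φ : QMap 3 3) : Φ.swapDual.swapDual = Φ :=
  ext_tensor fun i j k l => by simp [tensor_swapDual]

theorem swapDual_add (Φ Ψ : QMap 3 3) : (Φ + Ψ).swapDual = Φ.swapDual + Ψ.swapDual :=
  ext_tensor fun i j k l => by
    rw [tensor_swapDual]
    exact (congrArg₂ (· + ·) (tensor_swapDual Φ i j k l) (tensor_swapDual Ψ i j k l)).symm

theorem swapDual_smul (a : ℂ) (Φ : QMap 3 3) : (a • Φ).swapDual = a • Φ.swapDual :=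
  ext_tensor fun i j k l => by
    rw [tensor_swapDual]
    exact (congrArg (a * ·) (tensor_swapDual Φ i j k l)).symm

theorem form_swapDual (Φ : QMap 3 3) (x y : Fin 3 → ℂ) :
    Φ.swapDual.form x y = Φ.form (y ∘ Equiv.swap 0 1) (x ∘ Equiv.swap 0 1) := by
  rw [form_eq_sum, form_eq_sum, Finset.sum_comm_pairs, Finset.sum_comm,
    ← Equiv.sum_comp (Equiv.swap 0 1)]
  refine Finset.sum_congr rfl fun l _ => ?_
  rw [← Equiv.sum_comp (Equiv.swap 0 1)]
  refine Finset.sum_congr rfl fun k _ => ?_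
  rw [Finset.sum_comm, ← Equiv.sum_comp (Equiv.swap 0 1)]
  refine Finset.sum_congr rfl fun j _ => ?_
  rw [← Equiv.sum_comp (Equiv.swap 0 1)]
  refine Finset.sum_congr rfl fun i _ => ?_
  simp only [tensor_swapDual, Equiv.swap_apply_self, Function.comp]
  ring

theorem IsPositive.swapDual {Φ : QMap 3 3} (h : Φ.IsPositive) : Φ.swapDual.IsPositive := by
  rw [isPositive_iff_form_nonneg] at h ⊢
  intro x y
  rw [form_swapDual]
  exact h _ _

theorem IsExtremePositive.swapDual {Φ : QMap 3 3} (h : Φ.IsExtremePositive) :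
    Φ.swapDual.IsExtremePositive := by
  obtain ⟨hpos, hne, hext⟩ := h
  refine ⟨hpos.swapDual, fun h0 => hne ?_, ?_⟩
  · rw [← swapDual_swapDual Φ, h0]
    exact ext_tensor fun i j k l => by simp [tensor_swapDual]; simp [tensor]
  · intro Φ₁ Φ₂ h₁ h₂ hadd
    obtain ⟨s, t, hs, ht, hs', ht'⟩ := hext Φ₁.swapDual Φ₂.swapDual h₁.swapDual h₂.swapDual
      (by rw [← swapDual_add, hadd, swapDual_swapDual])
    exact ⟨s, t, hs, ht, by rw [← swapDual_smul, ← hs', swapDual_swapDual],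
      by rw [← swapDual_smul, ← ht', swapDual_swapDual]⟩

end QMap

/-! ### Coefficient relations along the circles and the curve of zeros -/

/-- A trigonometric polynomial of degree two that vanishes on the circle has zero coefficients. -/
theorem trigPoly_coeff_eq_zero {a b c d : ℂ}
    (h : ∀ w : ℂ, w * star w = 1 → a * w ^ 2 + b * w + c + d * star w = 0) :
    a = 0 ∧ b = 0 ∧ c = 0 ∧ d = 0 := by
  have h1 := h 1 (by simp)
  have h2 := h (-1) (by simp)
  have h3 := h Complex.I (by simp)
  have h4 := h (-Complex.I) (by simp)
  simp only [star_one, star_neg, Complex.star_def, Complex.conj_I] at h1 h2 h3 h4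
  have hI : Complex.I ^ 2 = -1 := Complex.I_sq
  have ha : a = 0 := by linear_combination (h1 + h2 - h3 - h4) / 4 + a / 2 * hI
  have hc : c = 0 := by linear_combination (h1 + h2 + h3 + h4) / 4 - a / 2 * hI
  have h5 : b + d = 0 := by linear_combination (h1 - h2) / 2
  have h6 : b - d = 0 := by linear_combination -(Complex.I * (h3 - h4)) / 2 + (b - d) * hI
  exact ⟨ha, by linear_combination (h5 + h6) / 2, hc, by linear_combination (h5 - h6) / 2⟩

theorem cubic_coeff_eq_zero {a b c d : ℂ}
    (h : ∀ g : ℝ, a + b * g + c * g ^ 2 + d * g ^ 3 = 0) :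
    a = 0 ∧ b = 0 ∧ c = 0 ∧ d = 0 := by
  have h0 := h 0
  have h1 := h 1
  have h2 := h (-1)
  have h3 := h 2
  push_cast at h0 h1 h2 h3
  have ha : a = 0 := by linear_combination h0
  have hc : c = 0 := by linear_combination (h1 + h2) / 2 - h0
  have h5 : b + d = 0 := by linear_combination (h1 - h2) / 2
  have h6 : 2 * b + 8 * d = 0 := by linear_combination h3 - ha - 4 * hc
  exact ⟨ha, by linear_combination (8 * h5 - h6) / 6, hc, by linear_combination (h6 - 2 * h5) / 6⟩

/-- The relations between the coefficients of a cubic form that vanishes on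
`(1, ±1, w), (1, ±1, w), (1, ±1, w⁻¹)` for all `w` on the unit circle. -/
def CircleRelations (F : Fin 3 → Fin 3 → Fin 3 → ℂ) : Prop :=
    F 2 2 0 = 0 ∧ F 2 2 1 = 0 ∧
    F 0 0 2 + F 1 1 2 = 0 ∧ F 0 1 2 + F 1 0 2 = 0 ∧
    F 2 0 0 + F 2 1 1 + F 0 2 0 + F 1 2 1 + F 2 2 2 = 0 ∧
    F 2 0 1 + F 2 1 0 + F 0 2 1 + F 1 2 0 = 0 ∧
    F 0 0 0 + F 0 1 1 + F 1 0 1 + F 1 1 0 + F 2 0 2 + F 0 2 2 = 0 ∧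
    F 0 0 1 + F 0 1 0 + F 1 0 0 + F 1 1 1 + F 2 1 2 + F 1 2 2 = 0

/-- The relations between the coefficients of a cubic form that vanishes on the curve
`(s - i g, -i n g), (s + i g, i n g), (m, 1 + i g)`. -/
def CurveRelations (m n s : ℂ) (F : Fin 3 → Fin 3 → Fin 3 → ℂ) : Prop :=
    m * F 0 0 0 + F 0 0 1 = 0 ∧
    n * (m * F 0 1 0 + F 0 1 1 - m * F 1 0 0 - F 1 0 1) + s * F 0 0 1 = 0 ∧
    m * F 0 0 0 + F 0 0 1 + n * (m * F 0 1 0 + F 0 1 1 + m * F 1 0 0 + F 1 0 1) +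
      n ^ 2 * (m * F 1 1 0 + F 1 1 1) - s * n * (F 0 1 1 - F 1 0 1) = 0 ∧
    F 0 0 1 + n * F 0 1 1 + n * F 1 0 1 + n ^ 2 * F 1 1 1 = 0

/-- For fixed e the sum is a trigonometric polynomial in w with exponents from -1 to 2, so each
coefficient vanishes; comparing e = 1 with e = -1 splits each coefficient into two relations. -/
theorem cubic_relations_of_circle {F : Fin 3 → Fin 3 → Fin 3 → ℂ}
    (h : ∀ e w : ℂ, e ^ 2 = 1 → w * star w = 1 →
      ∑ p, ∑ q, ∑ r, ![1, e, w] p * ![1, e, w] q * ![1, e, star w] r * F p q r = 0) :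
    CircleRelations F := by
  have key : ∀ e : ℂ, e ^ 2 = 1 →
      F 2 2 0 + e * F 2 2 1 = 0 ∧
      (F 2 0 0 + F 2 1 1 + F 0 2 0 + F 1 2 1 + F 2 2 2) +
        e * (F 2 0 1 + F 2 1 0 + F 0 2 1 + F 1 2 0) = 0 ∧
      (F 0 0 0 + F 0 1 1 + F 1 0 1 + F 1 1 0 + F 2 0 2 + F 0 2 2) +
        e * (F 0 0 1 + F 0 1 0 + F 1 0 0 + F 1 1 1 + F 2 1 2 + F 1 2 2) = 0 ∧
      (F 0 0 2 + F 1 1 2) + e * (F 0 1 2 + F 1 0 2) = 0 := by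
    intro e he
    refine trigPoly_coeff_eq_zero fun w hw => ?_
    have := h e w he hw
    simp only [Fin.sum_univ_three, cons_val_zero, cons_val_one, cons_val_two, head_cons,
      tail_cons] at this
    linear_combination this - (w * F 2 2 2 + F 2 0 2 + F 0 2 2 + e * F 2 1 2 + e * F 1 2 2) * hw
      - (w * (F 2 1 1 + F 1 2 1) + F 0 1 1 + F 1 0 1 + F 1 1 0 + star w * F 1 1 2 + e * F 1 1 1) * he
  obtain ⟨a1, a2, a3, a4⟩ := key 1 (by norm_num)
  obtain ⟨b1, b2, b3, b4⟩ := key (-1) (by norm_num)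
  refine ⟨?_, ?_, ?_, ?_, ?_, ?_, ?_, ?_⟩
  · linear_combination (a1 + b1) / 2
  · linear_combination (a1 - b1) / 2
  · linear_combination (a4 + b4) / 2
  · linear_combination (a4 - b4) / 2
  · linear_combination (a2 + b2) / 2
  · linear_combination (a2 - b2) / 2
  · linear_combination (a3 + b3) / 2
  · linear_combination (a3 - b3) / 2

/-- The four relations are the coefficients of 1, g, g², g³. The two lowest carry factors s² and s,
which is why s = 0 has to be excluded. -/
theorem cubic_relations_of_curve {F : Fin 3 → Fin 3 → Fin 3 → ℂ} {m n s : ℂ} (hs : s ≠ 0)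
    (h : ∀ g : ℝ, ∑ p, ∑ q, ∑ r, ![s - Complex.I * g, -(Complex.I * n * g), 0] p *
      ![s + Complex.I * g, Complex.I * n * g, 0] q * ![m, 1 + Complex.I * g, 0] r * F p q r = 0) :
    CurveRelations m n s F := by
  have hI : Complex.I ^ 2 = -1 := Complex.I_sq
  obtain ⟨h0, h1, h2, h3⟩ := cubic_coeff_eq_zero
    (a := s ^ 2 * (m * F 0 0 0 + F 0 0 1))
    (b := Complex.I * s * (n * (m * F 0 1 0 + F 0 1 1 - m * F 1 0 0 - F 1 0 1) + s * F 0 0 1))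
    (c := m * F 0 0 0 + F 0 0 1 + n * (m * F 0 1 0 + F 0 1 1 + m * F 1 0 0 + F 1 0 1) +
      n ^ 2 * (m * F 1 1 0 + F 1 1 1) - s * n * (F 0 1 1 - F 1 0 1))
    (d := Complex.I * (F 0 0 1 + n * F 0 1 1 + n * F 1 0 1 + n ^ 2 * F 1 1 1)) (fun g => by
      have := h g
      simp only [Fin.sum_univ_three, cons_val_zero, cons_val_one, cons_val_two, head_cons,
        tail_cons] at this
      linear_combination this + (g : ℂ) ^ 2 * (m * F 0 0 0 + (1 + Complex.I * g) * F 0 0 1 +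
        n * (m * F 0 1 0 + (1 + Complex.I * g) * F 0 1 1) - s * n * F 0 1 1 +
        n * (m * F 1 0 0 + (1 + Complex.I * g) * F 1 0 1) + s * n * F 1 0 1 +
        n ^ 2 * (m * F 1 1 0 + (1 + Complex.I * g) * F 1 1 1)) * hI)
  have hI0 := Complex.I_ne_zero
  refine ⟨?_, ?_, h2, ?_⟩
  · simpa [hs] using h0
  · simpa [hs, hI0] using h1
  · simpa [hI0] using h3

namespace QMap

theorem NullAt.circleRelations {D : QMap 3 3}
    (h : ∀ e w : ℂ, e ^ 2 = 1 → w * star w = 1 → D.NullAt ![1, e, w] ![1, e, w]) (a : Fin 3) :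
    CircleRelations (fun i l j => D.tensor i j a l) ∧
    CircleRelations (fun j k i => D.tensor i j k a) ∧
    CircleRelations (fun i l k => D.tensor i a k l) ∧
    CircleRelations (fun j k l => D.tensor a j k l) := by
  have hself : ∀ e : ℂ, e ^ 2 = 1 → star e = e := by
    intro e he
    rcases sq_eq_one_iff.1 he with rfl | rfl <;> simp
  have hstar : ∀ e w : ℂ, e ^ 2 = 1 → ∀ i, star (![1, e, w] i) = ![1, e, star w] i := by
    intro e w he i
    fin_cases i
    · simp
    · exact hself e he
    · rfl
  refine ⟨?_, ?_, ?_, ?_⟩ <;> refine cubic_relations_of_circle fun e w he hw => ?_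
  · rw [← (h e w he hw).output_right a]
    simp only [hstar e _ he, Fin.sum_univ_three]
    ring
  -- The left conditions contain two conjugated coordinates and one unconjugated, so the point with
  -- `star w` brings them to the same shape.
  · rw [← (h e (star w) he (by rw [star_star, mul_comm]; exact hw)).output_left a]
    simp only [hstar e _ he, star_star, Fin.sum_univ_three]
    ring
  · rw [← (h e w he hw).input_right a]
    simp only [hstar e _ he, Fin.sum_univ_three]
    ring
  · rw [← (h e (star w) he (by rw [star_star, mul_comm]; exact hw)).input_left a]
    simp only [hstar e _ he, star_star, Fin.sum_univ_three]

theorem NullAt.curveRelations {D : QMap 3 3} {m n s : ℝ} (hs : s ≠ 0)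
    (h : ∀ g : ℝ, D.NullAt ![s - Complex.I * g, -(Complex.I * n * g), 0]
      ![m, 1 + Complex.I * g, 0]) (a : Fin 3) :
    CurveRelations m n s (fun i j l => D.tensor i j a l) ∧
    CurveRelations m n s (fun j i k => D.tensor i j k a) := by
  have hx : ∀ (g : ℝ) i, star (![(s : ℂ) - Complex.I * g, -(Complex.I * n * g), 0] i) =
      ![(s : ℂ) + Complex.I * g, Complex.I * n * g, 0] i := by
    intro g i
    fin_cases i <;> simp
  have hy : ∀ (g : ℝ) i, star (![(m : ℂ), 1 + Complex.I * g, 0] i) =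
      ![(m : ℂ), 1 + Complex.I * (-g : ℝ), 0] i := by
    intro g i
    fin_cases i <;> simp
  refine ⟨?_, ?_⟩ <;>
    refine cubic_relations_of_curve (Complex.ofReal_ne_zero.2 hs) fun g => ?_
  · refine Eq.trans ?_ ((h g).output_right a)
    simp only [hx]
  · refine Eq.trans ?_ ((h (-g)).output_left a)
    simp only [hx, hy, Fin.sum_univ_three, cons_val_zero, cons_val_one, cons_val_two, head_cons,
      tail_cons]
    push_cast
    ring

end QMap

/-! ### Linear elimination of the tensor entries -/

section Elimination

variable {T : Fin 3 → Fin 3 → Fin 3 → Fin 3 → ℂ}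

/-- The coefficients of positive weight with respect to the action of the circle on the last
coordinate. -/
theorem eq_zero_of_weight_pos {m : ℂ} (hm : m ^ 2 ≠ 1)
    (hR : ∀ a, CircleRelations (fun i l j => T i j a l))
    (hL : ∀ a, CircleRelations (fun j k i => T i j k a))
    (hIR : ∀ a, CircleRelations (fun i l k => T i a k l))
    (hIL : ∀ a, CircleRelations (fun j k l => T a j k l))
    (hK : ∀ a, T 1 1 a 2 = 0) (hJ : ∀ a, T 2 a 0 0 = 0)
    (h1 : m * T 0 0 0 2 + T 0 0 1 2 = 0)
    (h2 : m ^ 2 * T 2 0 0 0 + m * (T 2 0 0 1 + T 2 0 1 0) + T 2 0 1 1 = 0) :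
    (∀ j k l, j ≠ 2 → k ≠ 2 → T 2 j k l = 0) ∧ (∀ i j k, i ≠ 2 → j ≠ 2 → k ≠ 2 → T i j k 2 = 0) ∧
    (∀ j, j ≠ 2 → T 2 j 2 2 = 0) ∧ (∀ k, k ≠ 2 → T 2 2 k 2 = 0) := by
  obtain ⟨r1, r2, -, -, r3, r4, -⟩ := hR 0
  obtain ⟨r5, r6, -, -, r7, r8, -⟩ := hR 1
  obtain ⟨r9, r10, -⟩ := hR 2
  obtain ⟨-, -, l1, l2, -⟩ := hL 0
  obtain ⟨-, -, l3, l4, -⟩ := hL 1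
  obtain ⟨-, -, l5, l6, -⟩ := hIL 0
  obtain ⟨-, -, l7, l8, -⟩ := hIL 1
  obtain ⟨i1, i2, -⟩ := hIR 2
  simp only at *
  have j0 := hJ 0
  have j1 := hJ 1
  have k0 := hK 0
  have k1 := hK 1
  have t2110 : T 2 1 1 0 = 0 := by linear_combination l1 - j0
  have t2010 : T 2 0 1 0 = 0 := by linear_combination l2 - j1
  have t1002 : T 1 0 0 2 = 0 := by linear_combination l7 - k1
  have t1012 : T 1 0 1 2 = 0 := by linear_combination l8 - k0
  have hm' : 1 - m ^ 2 ≠ 0 := fun h => hm (by linear_combination -h)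
  -- By the circle relations and `h1`, T 2 0 0 1 = -m T 0 0 0 2 and T 2 0 1 1 = T 0 0 0 2, so `h2`
  -- collapses to this equation.
  have t0002 : T 0 0 0 2 = 0 := by
    refine (mul_eq_zero.1 (?_ : (1 - m ^ 2) * T 0 0 0 2 = 0)).resolve_left hm'
    linear_combination h2 - m * h1 - m ^ 2 * j0 - m * t2010 - l4 + r3 - j0 - k0 - i1
      + m * l6 - m * r4 + m * j1 + m * t1002
  have t0012 : T 0 0 1 2 = 0 := by linear_combination h1 - m * t0002
  have t0102 : T 0 1 0 2 = 0 := by linear_combination l6 - t0012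
  have t0112 : T 0 1 1 2 = 0 := by linear_combination l5 - t0002
  have t2101 : T 2 1 0 1 = 0 := by linear_combination r3 - j0 - t0002 - k0 - i1
  have t2001 : T 2 0 0 1 = 0 := by linear_combination r4 - j1 - t0102 - t1002
  have t2011 : T 2 0 1 1 = 0 := by linear_combination l4 - t2101
  have t2111 : T 2 1 1 1 = 0 := by linear_combination l3 - t2001
  simp only [Fin.forall_fin_succ, Fin.succ_zero_eq_one, Fin.succ_one_eq_two]
  refine ⟨?_, ?_, ?_, ?_⟩ <;> simp_all

/-- The coefficients of weight zero with respect to the action of the circle on the last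
coordinate. -/
theorem eq_zero_of_weight_zero {m n s : ℂ} (hm : m ≠ 0) (hn : n ≠ 0) (hs : s ≠ 0) (hmn : m ≠ n)
    (hR : ∀ a, CircleRelations (fun i l j => T i j a l))
    (hL : ∀ a, CircleRelations (fun j k i => T i j k a))
    (hIR : ∀ a, CircleRelations (fun i l k => T i a k l))
    (hIL : ∀ a, CircleRelations (fun j k l => T a j k l))
    (hC : ∀ a, CurveRelations m n s (fun i j l => T i j a l))
    (hC' : ∀ a, CurveRelations m n s (fun j i k => T i j k a))
    (hin : ∀ g : ℝ, ∑ i, ∑ k, ∑ l, ![s - Complex.I * g, -(Complex.I * n * g), 0] i *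
      ![m, 1 - Complex.I * g, 0] k * ![m, 1 + Complex.I * g, 0] l * T i 0 k l = 0)
    (hE0 : ∀ a, T 2 2 a 0 = 0) (hE1 : ∀ a, T 2 2 0 a = 0)
    (hE2 : ∀ a, T 1 a 2 2 = 0) (hE3 : ∀ a, T a 1 2 2 = 0) (h0 : T 0 0 0 0 = 0) :
    (∀ i j k l, i ≠ 2 → j ≠ 2 → k ≠ 2 → l ≠ 2 → T i j k l = 0) ∧
    (∀ i j, i ≠ 2 → j ≠ 2 → T i j 2 2 = 0) ∧ (∀ k l, k ≠ 2 → l ≠ 2 → T 2 2 k l = 0) ∧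
    (∀ j l, j ≠ 2 → l ≠ 2 → T 2 j 2 l = 0) ∧ (∀ i k, i ≠ 2 → k ≠ 2 → T i 2 k 2 = 0) ∧
    T 2 2 2 2 = 0 := by
  obtain ⟨a1, a2, a3, a4⟩ := hC 0
  obtain ⟨b1, b2, b3, b4⟩ := hC 1
  obtain ⟨c1, c2, c3, c4⟩ := hC' 0
  obtain ⟨d1, d2, d3, d4⟩ := hC' 1
  simp only at a1 a2 a3 a4 b1 b2 b3 b4 c1 c2 c3 c4 d1 d2 d3 d4
  have t0001 : T 0 0 0 1 = 0 := by linear_combination a1 - m * h0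
  have t0010 : T 0 0 1 0 = 0 := by linear_combination c1 - m * h0
  have t0011 : T 0 0 1 1 = 0 := by linear_combination b1 - m * t0010
  rw [h0, t0001] at a3
  rw [t0001] at a2 a4
  rw [t0010, t0011] at b3
  rw [t0011] at b2 b4
  rw [h0, t0010] at c3
  rw [t0010] at c2 c4
  rw [t0001, t0011] at d3
  rw [t0011] at d2 d4
  have cancel : ∀ {u v : ℂ}, u ≠ 0 → u * v = 0 → v = 0 :=
    fun hu h => (mul_eq_zero.1 h).resolve_left hu
  have w01 : T 0 1 0 1 + T 1 0 0 1 + n * T 1 1 0 1 = 0 :=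
    cancel hn (by linear_combination a4)
  have w11 : T 0 1 1 1 + T 1 0 1 1 + n * T 1 1 1 1 = 0 :=
    cancel hn (by linear_combination b4)
  have w10 : T 0 1 1 0 + T 1 0 1 0 + n * T 1 1 1 0 = 0 :=
    cancel hn (by linear_combination c4)
  have x11 : T 0 1 1 1 - T 1 0 1 1 = 0 :=
    cancel hs (cancel hn (by linear_combination -b3 + n * m * w10 + n * w11))
  have x10 : T 0 1 1 0 - T 1 0 1 0 = 0 :=
    cancel hm (cancel hn (by linear_combination b2 - n * x11))
  have x01 : T 0 1 0 1 - T 1 0 0 1 = 0 :=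
    cancel hm (cancel hn (by linear_combination -d2 - n * x11))
  have x00 : T 0 1 0 0 - T 1 0 0 0 = 0 :=
    cancel hm (cancel hn (by linear_combination a2 - n * x01))
  have w00 : T 0 1 0 0 + T 1 0 0 0 + n * T 1 1 0 0 = 0 :=
    cancel hm (cancel hn (by linear_combination a3 - n * w01 + s * n * x01))
  -- The curve relations have reduced the upper-left input block to the entries T 1 1 k l; the input
  -- condition along the curve now constrains these.
  have u00 : T 1 0 0 0 = -(n / 2) * T 1 1 0 0 := by linear_combination (w00 - x00) / 2
  have u01 : T 1 0 0 1 = -(n / 2) * T 1 1 0 1 := by linear_combination (w01 - x01) / 2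
  have u10 : T 1 0 1 0 = -(n / 2) * T 1 1 1 0 := by linear_combination (w10 - x10) / 2
  have u11 : T 1 0 1 1 = -(n / 2) * T 1 1 1 1 := by linear_combination (w11 - x11) / 2
  have v00 : T 0 1 0 0 = -(n / 2) * T 1 1 0 0 := by linear_combination (w00 + x00) / 2
  have v01 : T 0 1 0 1 = -(n / 2) * T 1 1 0 1 := by linear_combination (w01 + x01) / 2
  have v10 : T 0 1 1 0 = -(n / 2) * T 1 1 1 0 := by linear_combination (w10 + x10) / 2
  have v11 : T 0 1 1 1 = -(n / 2) * T 1 1 1 1 := by linear_combination (w11 + x11) / 2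
  have hI0 := Complex.I_ne_zero
  obtain ⟨-, p1, p2, p3⟩ := cubic_coeff_eq_zero (a := 0)
    (b := Complex.I * (n ^ 2 / 2) *
      (m ^ 2 * T 1 1 0 0 + m * (T 1 1 0 1 + T 1 1 1 0) + T 1 1 1 1))
    (c := -(n ^ 2 / 2) * m * (T 1 1 0 1 - T 1 1 1 0))
    (d := Complex.I * (n ^ 2 / 2) * T 1 1 1 1) (fun g => by
      have := hin g
      simp only [Fin.sum_univ_three, cons_val_zero, cons_val_one, cons_val_two, head_cons,
        tail_cons, h0, t0001, t0010, t0011, u00, u01, u10, u11] at this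
      linear_combination this + (n ^ 2 / 2) * (g : ℂ) ^ 2 * ((T 1 1 1 0 - T 1 1 0 1) * m
        + Complex.I * g * T 1 1 1 1) * Complex.I_sq)
  have hn2 : n ^ 2 / 2 ≠ 0 := by simp [hn]
  have z11 : T 1 1 1 1 = 0 := cancel (mul_ne_zero hI0 hn2) p3
  have zs : T 1 1 0 1 - T 1 1 1 0 = 0 := cancel (mul_ne_zero (neg_ne_zero.2 hn2) hm) p2
  have z00 : m * T 1 1 0 0 + 2 * T 1 1 1 0 = 0 := by
    refine cancel hm ?_
    linear_combination cancel (mul_ne_zero hI0 hn2) p1 - m * zs - z11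
  obtain ⟨-, -, -, -, -, -, r1, r2⟩ := hR 0
  obtain ⟨-, -, -, -, -, -, r3, r4⟩ := hR 1
  obtain ⟨-, -, -, -, r5, r6, -⟩ := hR 2
  obtain ⟨-, -, -, -, -, -, l1, l2⟩ := hIL 0
  obtain ⟨-, -, -, -, -, -, l3, l4⟩ := hIL 1
  obtain ⟨-, -, -, -, -, -, q1, q2⟩ := hL 0
  obtain ⟨-, -, -, -, -, -, q3, q4⟩ := hL 1
  obtain ⟨-, -, -, -, -, -, i1, i2⟩ := hIR 0
  obtain ⟨-, -, -, -, -, -, i3, i4⟩ := hIR 1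
  obtain ⟨-, -, i5, i6, -⟩ := hIR 2
  simp only [h0, t0001, t0010, t0011, u00, u01, u10, u11, v00, v01, v10, v11, z11, hE0, hE1, hE2,
    hE3, mul_zero, add_zero, zero_add] at r1 r2 r3 r4 r5 r6 l1 l2 l3 l4 q1 q2 q3 q4 i1 i2 i3 i4 i5 i6
  -- Eliminating T 0 2 1 2 between two circle relations gives T 1 1 1 0 = -(n/2) T 1 1 0 0, while
  -- `z00` gives m T 1 1 0 0 = -2 T 1 1 1 0; the two are compatible with a nonzero value only if m =
  -- n.
  have z10 : T 1 1 1 0 = 0 := by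
    refine cancel (sub_ne_zero.2 hmn) ?_
    linear_combination m * r3 - m * l2 - n / 2 * z00
  have z01 : T 1 1 0 1 = 0 := by linear_combination zs + z10
  have z00' : T 1 1 0 0 = 0 := cancel hm (by linear_combination z00 - 2 * z10)
  simp only [z00', z01, z10, z11, mul_zero] at u00 u01 u10 u11 v00 v01 v10 v11
  simp only [z00', z01, z10, mul_zero, add_zero, zero_add] at r1 r2 r3 r4 l1 l4 q1 q2 q3 q4
  simp only [r1, zero_add] at l1
  simp only [l4, add_zero] at r4
  simp only [r4, zero_add] at q4
  simp only [q1, q4, l1, zero_add] at r5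
  have e10 := hE2 0
  have e11 := hE2 1
  have e01 := hE3 0
  have f0 := hE0 0
  have f1 := hE0 1
  have f2 := hE1 1
  clear hR hL hIR hIL hC hC' hin hE0 hE1 hE2 hE3 a1 a2 a3 a4 b1 b2 b3 b4 c1 c2 c3 c4 d1 d2 d3 d4
    cancel w01 w11 w10 w00 x11 x10 x01 x00 p1 p2 p3 zs z00 i1 i2 i3 i4 i5 i6 r6 l2 l3
  simp only [Fin.forall_fin_succ, Fin.succ_zero_eq_one, Fin.succ_one_eq_two]
  refine ⟨?_, ?_, ?_, ?_, ?_, ?_⟩ <;> simp [*]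

end Elimination

/-! ### The zeros determine the map up to a factor -/

namespace QMap

/-- A linear map is zero if it satisfies the first-order conditions at sufficiently many points. -/
theorem eq_zero_of_nullAt {D : QMap 3 3} {m n s : ℝ} (hm : m ≠ 0) (hn : n ≠ 0) (hs : s ≠ 0)
    (hmn : m ≠ n) (hm1 : m ^ 2 ≠ 1) (h12 : D.NullAt ![0, 1, 0] ![0, 0, 1])
    (h20 : D.NullAt ![0, 0, 1] ![1, 0, 0])
    (hcircle : ∀ e w : ℂ, e ^ 2 = 1 → w * star w = 1 → D.NullAt ![1, e, w] ![1, e, w])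
    (hcurve : ∀ g : ℝ, D.NullAt ![s - Complex.I * g, -(Complex.I * n * g), 0]
      ![m, 1 + Complex.I * g, 0]) (h0 : D.tensor 0 0 0 0 = 0) : D = 0 := by
  have hR := fun a => (NullAt.circleRelations hcircle a).1
  have hL := fun a => (NullAt.circleRelations hcircle a).2.1
  have hIR := fun a => (NullAt.circleRelations hcircle a).2.2.1
  have hIL := fun a => (NullAt.circleRelations hcircle a).2.2.2
  have hC := fun a => (NullAt.curveRelations hs hcurve a).1
  have hC' := fun a => (NullAt.curveRelations hs hcurve a).2
  have hK : ∀ a, D.tensor 1 1 a 2 = 0 := fun a => by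
    simpa [Fin.sum_univ_three] using h12.output_right a
  have hK' : ∀ a, D.tensor 1 1 2 a = 0 := fun a => by
    simpa [Fin.sum_univ_three] using h12.output_left a
  have hE2 : ∀ a, D.tensor 1 a 2 2 = 0 := fun a => by
    simpa [Fin.sum_univ_three] using h12.input_right a
  have hE3 : ∀ a, D.tensor a 1 2 2 = 0 := fun a => by
    simpa [Fin.sum_univ_three] using h12.input_left a
  have hE0 : ∀ a, D.tensor 2 2 a 0 = 0 := fun a => by
    simpa [Fin.sum_univ_three] using h20.output_right a
  have hE1 : ∀ a, D.tensor 2 2 0 a = 0 := fun a => by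
    simpa [Fin.sum_univ_three] using h20.output_left a
  have hJ : ∀ a, D.tensor 2 a 0 0 = 0 := fun a => by
    simpa [Fin.sum_univ_three] using h20.input_right a
  have hJ' : ∀ a, D.tensor a 2 0 0 = 0 := fun a => by
    simpa [Fin.sum_univ_three] using h20.input_left a
  have hs' : (s : ℂ) ≠ 0 := Complex.ofReal_ne_zero.2 hs
  have hm' : (m : ℂ) ^ 2 ≠ 1 := by exact_mod_cast hm1
  have hc := hcurve 0
  have g1 := hc.output_left 2
  have g2 := hc.input_left 2
  have g3 := hc.output_right 2
  have g4 := hc.input_right 2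
  simp only [Fin.sum_univ_three, cons_val_zero, cons_val_one, cons_val_two, head_cons,
    tail_cons, Complex.ofReal_zero, mul_zero, neg_zero, zero_mul, add_zero, sub_zero,
    mul_one, Complex.star_def, Complex.conj_ofReal, map_zero, map_one] at g1 g2 g3 g4
  have P := eq_zero_of_weight_pos (T := D.tensor) hm' hR hL hIR hIL hK hJ
    (mul_left_cancel₀ (mul_ne_zero hs' hs') (by linear_combination g1))
    (mul_left_cancel₀ hs' (by linear_combination g2))
  -- Interchanging the indices within each pair reverses the weight and swaps left with right
  -- conditions, so the same lemma handles negative weights.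
  have N := eq_zero_of_weight_pos (T := fun i j k l => D.tensor j i l k) hm' hL hR hIL hIR hK' hJ'
    (mul_left_cancel₀ (mul_ne_zero hs' hs') (by linear_combination g3))
    (mul_left_cancel₀ hs' (by linear_combination g4))
  have Z := eq_zero_of_weight_zero (T := D.tensor) (Complex.ofReal_ne_zero.2 hm)
    (Complex.ofReal_ne_zero.2 hn) hs' (by exact_mod_cast hmn) hR hL hIR hIL hC hC' (fun g => by
      refine Eq.trans ?_ ((hcurve g).input_right 0)
      have hy : ∀ k, star (![(m : ℂ), 1 + Complex.I * g, 0] k) =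
          ![(m : ℂ), 1 - Complex.I * g, 0] k := by
        intro k
        fin_cases k <;> simp [sub_eq_add_neg]
      simp only [hy]) hE0 hE1 hE2 hE3 h0
  obtain ⟨P1, P2, P3, P4⟩ := P
  obtain ⟨N1, N2, N3, N4⟩ := N
  obtain ⟨Z1, Z2, Z3, Z4, Z5, Z6⟩ := Z
  refine ext_tensor fun i j k l => ?_
  change D.tensor i j k l = 0
  by_cases hi : i = 2 <;> by_cases hj : j = 2 <;> by_cases hk : k = 2 <;> by_cases hl : l = 2 <;>
    (try subst i) <;> (try subst j) <;> (try subst k) <;> (try subst l) <;>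
    first
    | exact Z6
    | exact P3 j hj
    | exact P4 k hk
    | exact N3 i hi
    | exact N4 l hl
    | exact Z2 i j hi hj
    | exact Z3 k l hk hl
    | exact Z4 j l hj hl
    | exact Z5 i k hi hk
    | exact P1 j k _ hj hk
    | exact P2 i j k hi hj hk
    | exact N1 i l _ hi hl
    | exact N2 j i l hj hi hl
    | exact Z1 i j k l hi hj hk hl

end QMap

/-! ### The form of `psi`, its symmetry, and the double leaf -/

theorem psi_apply (m n : ℝ) (z : Matrix (Fin 3) (Fin 3) ℂ) :
    psi m n z = psiBase m n z + (psiB m n : ℂ) • psiChoi z + (psiC m n : ℂ) • psiAnti z := rfl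

theorem psiB_comm (m n : ℝ) : psiB m n = psiB n m := by
  rw [psiB, psiB, min_comm]
  ring_nf

theorem psiC_comm (m n : ℝ) : psiC m n = psiC n m := by
  rw [psiC, psiC, max_comm]
  ring_nf

theorem psi_form (m n : ℝ) (x y : Fin 3 → ℂ) :
    (psi m n).form x y =
      (n * (x 0 + m * x 1) * star (y 0) - m * (n * x 0 - x 1) * star (y 1)
          - (m + n) * x 2 * star (y 2)) *
        (n * (star (x 0) + m * star (x 1)) * y 0 - m * (n * star (x 0) - star (x 1)) * y 1
          - (m + n) * star (x 2) * y 2) +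
      psiB m n * (x 1 * star (x 1) * (y 0 * star (y 0)) + x 2 * star (x 2) * (y 1 * star (y 1)) +
        (x 0 * star (x 0) + x 2 * star (x 2)) * (y 2 * star (y 2)) -
        x 0 * star (x 2) * (star (y 0) * y 2) - star (x 0) * x 2 * (y 0 * star (y 2)) -
        x 1 * star (x 2) * (star (y 1) * y 2) - star (x 1) * x 2 * (y 1 * star (y 2))) +
      psiC m n * ((x 0 * star (x 1) - x 1 * star (x 0)) *
        (star (y 0) * y 1 - star (y 1) * y 0)) := by
  simp only [QMap.form, psi_apply, psiBase, psiChoi, psiAnti, dotProduct, mulVec,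
    Fin.sum_univ_three, vecMulVec_apply, Pi.star_apply, Matrix.add_apply, Matrix.smul_apply,
    of_apply, cons_val', cons_val_zero, cons_val_one, cons_val_two, cons_val_fin_one, head_cons,
    tail_cons, head_fin_const, smul_eq_mul]
  ring

theorem swapDual_psi (m n : ℝ) : (psi m n).swapDual = psi n m := by
  have h0 : (Equiv.swap 0 1 : Equiv.Perm (Fin 3)) 0 = 1 := by decide
  have h1 : (Equiv.swap 0 1 : Equiv.Perm (Fin 3)) 1 = 0 := by decide
  have h2 : (Equiv.swap 0 1 : Equiv.Perm (Fin 3)) 2 = 2 := by decide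
  ext1 z
  ext k l
  simp only [QMap.swapDual, LinearMap.coe_mk, AddHom.coe_mk, of_apply, Fin.sum_univ_three]
  simp only [psi_apply]
  fin_cases k <;> fin_cases l <;>
    simp [h0, h1, h2, QMap.tensor, psi_apply, psiBase, psiChoi, psiAnti,
      psiB_comm n m, psiC_comm n m] <;> ring

theorem psiB_of_sq_le {m n : ℝ} (h : m ^ 2 ≤ n ^ 2) :
    psiB m n = -2 * m * n - m ^ 2 * n ^ 2 - n ^ 2 :=
  min_eq_left (by linarith)

theorem psiC_of_sq_le {m n : ℝ} (h : m ^ 2 ≤ n ^ 2) (hmn : m * n ≤ 0) :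
    psiC m n = m * n * (√(1 - n ^ 2) - 1 - m * n) / 2 := by
  have h1 : √(1 - n ^ 2) ≤ √(1 - m ^ 2) := Real.sqrt_le_sqrt (by linarith)
  rw [psiC, max_eq_left (by nlinarith)]
  ring

theorem psiB_nonneg {m n : ℝ} (h : (m, n) ∈ doubleLeaf) : 0 ≤ psiB m n :=
  le_min h.2.2.1 h.2.2.2

theorem mul_nonpos_of_mem_doubleLeaf {m n : ℝ} (h : (m, n) ∈ doubleLeaf) : m * n ≤ 0 := by
  have := h.2.2.1
  simp only at this
  nlinarith [sq_nonneg (m * n), sq_nonneg n]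

theorem swap_mem_doubleLeaf {m n : ℝ} (h : (m, n) ∈ doubleLeaf) : (n, m) ∈ doubleLeaf := by
  obtain ⟨h1, h2, h3, h4⟩ := h
  simp only at h1 h2 h3 h4
  exact ⟨h2, h1, by simp only; linarith, by simp only; linarith⟩

theorem doubleLeaf_ne_zero {m n : ℝ} (h : (m, n) ∈ doubleLeaf) (h0 : (m, n) ≠ (0, 0)) :
    m ≠ 0 ∧ n ≠ 0 := by
  obtain ⟨-, -, h3, h4⟩ := h
  simp only at h3 h4
  constructor
  · rintro rfl
    exact h0 (by simp; nlinarith [sq_nonneg n])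
  · rintro rfl
    exact h0 (by simp; nlinarith [sq_nonneg m])

theorem sq_le_one_of_mem_doubleLeaf {m n : ℝ} (h : (m, n) ∈ doubleLeaf) : n ^ 2 ≤ 1 := by
  obtain ⟨-, ⟨h1, h2⟩, -⟩ := h
  simp only at h1 h2
  nlinarith

/-- The boundary of the double leaf is the zero set of `psiB`. -/
theorem mem_frontier_doubleLeaf_iff {m n : ℝ} (h : (m, n) ∈ doubleLeaf) :
    (m, n) ∈ frontier doubleLeaf ↔ psiB m n = 0 := by
  have hcl : IsClosed doubleLeaf := by
    refine IsClosed.and ?_ (IsClosed.and ?_ (IsClosed.and ?_ ?_))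
    · exact isClosed_Icc.preimage continuous_fst
    · exact isClosed_Icc.preimage continuous_snd
    · exact isClosed_le (by fun_prop) (by fun_prop)
    · exact isClosed_le (by fun_prop) (by fun_prop)
  rw [hcl.frontier_eq]
  constructor
  · rintro ⟨-, hint⟩
    by_contra hb
    have hpos : 0 < psiB m n := lt_of_le_of_ne (psiB_nonneg h) (Ne.symm hb)
    obtain ⟨h3, h4⟩ := lt_min_iff.1 hpos
    refine hint (mem_interior.2 ⟨{p : ℝ × ℝ | 0 < 1 - p.1 ^ 2 ∧ 0 < 1 - p.2 ^ 2 ∧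
      0 < -2 * p.1 * p.2 - p.1 ^ 2 * p.2 ^ 2 - p.2 ^ 2 ∧
      0 < -2 * p.1 * p.2 - p.1 ^ 2 * p.2 ^ 2 - p.1 ^ 2}, ?_, ?_, ?_⟩)
    · rintro ⟨a, c⟩ ⟨h1, h2, h3, h4⟩
      simp only at h1 h2 h3 h4
      refine ⟨?_, ?_, h3.le, h4.le⟩ <;> rw [Set.mem_Icc, ← abs_le] <;>
        refine (sq_le_one_iff_abs_le_one _).1 ?_ <;> simp only <;> linarith
    · refine IsOpen.and ?_ (IsOpen.and ?_ (IsOpen.and ?_ ?_)) <;>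
        exact isOpen_lt (by fun_prop) (by fun_prop)
    -- If m² = 1 or n² = 1, one of the strict inequalities becomes 0 < -(m+n)².
    · refine ⟨?_, ?_, h3, h4⟩
      · have := sq_le_one_of_mem_doubleLeaf (swap_mem_doubleLeaf h)
        rcases this.lt_or_eq with h5 | h5
        · simpa using h5
        · rw [h5] at h4
          nlinarith [sq_nonneg (m + n)]
      · have := sq_le_one_of_mem_doubleLeaf h
        rcases this.lt_or_eq with h5 | h5
        · simpa using h5
        · rw [h5] at h3
          nlinarith [sq_nonneg (m + n)]
  · intro hb
    refine ⟨h, fun hint => ?_⟩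
    have hnhds : doubleLeaf ∈ nhds (m, n) := mem_interior_iff_mem_nhds.1 hint
    by_cases h0 : (m, n) = (0, 0)
    · obtain ⟨rfl, rfl⟩ := Prod.mk.inj h0
      have hc : Filter.Tendsto (fun t : ℝ => (t, t)) (nhdsWithin 0 (Set.Ioi 0)) (nhds (0, 0)) :=
        (Continuous.tendsto' (by fun_prop) _ _ rfl).mono_left nhdsWithin_le_nhds
      obtain ⟨t, ht, ht0⟩ := ((hc.eventually hnhds).and self_mem_nhdsWithin).exists
      have := ht.2.2.1
      simp only at this
      have ht0' : (0 : ℝ) < t := ht0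
      nlinarith [sq_nonneg (t * t), mul_pos ht0' ht0']
    · obtain ⟨hm, hn⟩ := doubleLeaf_ne_zero h h0
      -- Stretching the coordinate of larger modulus by t > 1 leaves the set: on b = 0 the active
      -- constraint becomes a negative multiple of t(t-1).
      rcases le_total (m ^ 2) (n ^ 2) with hle | hle
      · rw [psiB_of_sq_le hle] at hb
        have hc : Filter.Tendsto (fun t : ℝ => (m, n * t)) (nhdsWithin 1 (Set.Ioi 1))
            (nhds (m, n)) :=
          (Continuous.tendsto' (by fun_prop) _ _ (by simp)).mono_left nhdsWithin_le_nhds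
        obtain ⟨t, ht, ht0⟩ := ((hc.eventually hnhds).and self_mem_nhdsWithin).exists
        have h3 := ht.2.2.1
        simp only at h3
        have ht0' : 0 < t - 1 := sub_pos.2 ht0
        have hn2 : 0 < n ^ 2 * (1 + m ^ 2) := by positivity
        have h4 : -2 * m * (n * t) - m ^ 2 * (n * t) ^ 2 - (n * t) ^ 2 =
            -(n ^ 2 * (1 + m ^ 2)) * (t * (t - 1)) := by linear_combination t * hb
        rw [h4] at h3
        nlinarith [mul_pos hn2 (mul_pos (by linarith : 0 < t) ht0')]
      · rw [psiB_comm, psiB_of_sq_le hle] at hb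
        have hc : Filter.Tendsto (fun t : ℝ => (m * t, n)) (nhdsWithin 1 (Set.Ioi 1))
            (nhds (m, n)) :=
          (Continuous.tendsto' (by fun_prop) _ _ (by simp)).mono_left nhdsWithin_le_nhds
        obtain ⟨t, ht, ht0⟩ := ((hc.eventually hnhds).and self_mem_nhdsWithin).exists
        have h3 := ht.2.2.2
        simp only at h3
        have ht0' : 0 < t - 1 := sub_pos.2 ht0
        have hn2 : 0 < m ^ 2 * (1 + n ^ 2) := by positivity
        have h4 : -2 * (m * t) * n - (m * t) ^ 2 * n ^ 2 - (m * t) ^ 2 =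
            -(m ^ 2 * (1 + n ^ 2)) * (t * (t - 1)) := by linear_combination t * hb
        rw [h4] at h3
        nlinarith [mul_pos hn2 (mul_pos (by linarith : 0 < t) ht0')]

theorem psi_tensor_zero (m n : ℝ) : (psi m n).tensor 0 0 0 0 = (n : ℂ) ^ 2 := by
  simp [QMap.tensor, psi_apply, psiBase, psiChoi, psiAnti]

/-! ### Zeros of the form -/

section Zeros

variable (m n : ℝ)

theorem psi_form_basis_one_two : (psi m n).form ![0, 1, 0] ![0, 0, 1] = 0 := by
  simp [psi_form]

theorem psi_form_basis_two_zero : (psi m n).form ![0, 0, 1] ![1, 0, 0] = 0 := by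
  simp [psi_form]

theorem psi_form_circle {e w : ℂ} (he : e ^ 2 = 1) (hw : w * star w = 1) :
    (psi m n).form ![1, e, w] ![1, e, w] = 0 := by
  have he' : star e = e := by
    rcases sq_eq_one_iff.1 he with rfl | rfl <;> simp
  simp only [psi_form, cons_val_zero, cons_val_one, cons_val_two, head_cons, tail_cons, star_one,
    he']
  have hL : n * (1 + m * e) * 1 - m * (n * 1 - e) * e - (m + n) * w * star w = (0 : ℂ) := by
    linear_combination m * he - (m + n) * hw
  linear_combination (n * (1 + m * e) * 1 - m * (n * 1 - e) * e - (m + n) * star w * w) * hL +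
    psiB m n * (w * star w - e ^ 2) * hw

/-- For x = (1,z,0) the upper 2×2 minor of Ψ(xx†) is b m² (|z|² - n Re z)². Here z = x₁/x₀ lies on
the circle |z|² = n Re z, and y is a null vector of that block. -/
theorem psi_form_curve {m n : ℝ} (h : m ^ 2 ≤ n ^ 2) (hmn : m * n ≤ 0) (hn : n ^ 2 ≤ 1) (g : ℝ) :
    (psi m n).form ![(√(1 - n ^ 2) : ℝ) - Complex.I * g, -(Complex.I * n * g), 0]
      ![m, 1 + Complex.I * g, 0] = 0 := by
  have hs : (√(1 - n ^ 2)) ^ 2 = 1 - n ^ 2 := Real.sq_sqrt (by linarith)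
  rw [psi_form, psiC_of_sq_le h hmn, psiB_of_sq_le h]
  generalize √(1 - n ^ 2) = s at hs
  have hs' : (s : ℂ) ^ 2 = 1 - (n : ℂ) ^ 2 := by exact_mod_cast hs
  have hx : star ((s : ℂ) - Complex.I * g) = s + Complex.I * g := by simp
  have hx' : star (-(Complex.I * n * g)) = Complex.I * n * g := by simp
  have hy : star (1 + Complex.I * g) = 1 - Complex.I * g := by simp [sub_eq_add_neg]
  have hm : star (m : ℂ) = m := by simp
  simp only [cons_val_zero, cons_val_one, cons_val_two, head_cons, tail_cons, star_zero, hx, hx',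
    hy, hm]
  push_cast
  linear_combination (Complex.I ^ 2 * m ^ 2 * n ^ 2 * g ^ 2) * hs'

end Zeros

/-! ### Positivity through leading minors -/

/-- Completing the square twice: after multiplication by the first two leading minors the form is a
sum of squared moduli, the last one weighted by the determinant. -/
theorem hermitianForm_nonneg {a d e : ℝ} {p q r : ℂ} (ha : 0 < a)
    (hmin : 0 < a * d - Complex.normSq p)
    (hdet : 0 ≤ a * d * e + 2 * (p * q * star r).re - a * Complex.normSq q -
      d * Complex.normSq r - e * Complex.normSq p) (y₀ y₁ y₂ : ℂ) :
    0 ≤ a * Complex.normSq y₀ + d * Complex.normSq y₁ + e * Complex.normSq y₂ +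
      2 * (star y₀ * p * y₁).re + 2 * (star y₀ * r * y₂).re + 2 * (star y₁ * q * y₂).re := by
  refine (mul_nonneg_iff_of_pos_left (mul_pos ha hmin)).1 ?_
  have key : (a * (a * d - Complex.normSq p)) * (a * Complex.normSq y₀ + d * Complex.normSq y₁ +
      e * Complex.normSq y₂ +
      2 * (star y₀ * p * y₁).re + 2 * (star y₀ * r * y₂).re + 2 * (star y₁ * q * y₂).re) =
      (a * d - Complex.normSq p) * Complex.normSq (a * y₀ + p * y₁ + r * y₂) +
      Complex.normSq (((a * d - Complex.normSq p : ℝ) : ℂ) * y₁ + (a * q - star p * r) * y₂) +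
      a * (a * d * e + 2 * (p * q * star r).re - a * Complex.normSq q -
      d * Complex.normSq r - e * Complex.normSq p) * Complex.normSq y₂ := by
    simp only [Complex.normSq_apply, Complex.mul_re, Complex.mul_im, Complex.add_re,
      Complex.add_im, Complex.sub_re, Complex.sub_im, Complex.star_def, Complex.conj_re,
      Complex.conj_im, Complex.ofReal_re, Complex.ofReal_im]
    ring
  rw [key]
  have h1 := Complex.normSq_nonneg (a * y₀ + p * y₁ + r * y₂)
  have h2 := Complex.normSq_nonneg
    (((a * d - Complex.normSq p : ℝ) : ℂ) * y₁ + (a * q - star p * r) * y₂)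
  have h3 := Complex.normSq_nonneg y₂
  positivity

/-- A concave quadratic polynomial that is nonnegative at two points is nonnegative in between. -/
theorem concave_quadratic_nonneg {α β γ a b t : ℝ} (hγ : 0 ≤ γ) (hat : a ≤ t) (htb : t ≤ b)
    (ha : 0 ≤ α + β * a - γ * a ^ 2) (hb : 0 ≤ α + β * b - γ * b ^ 2) :
    0 ≤ α + β * t - γ * t ^ 2 := by
  rcases hat.eq_or_lt with rfl | hat'
  · exact ha
  · have hba : 0 < b - a := by linarith
    refine (mul_nonneg_iff_of_pos_left hba).1 ?_
    have h1 : 0 ≤ t - a := by linarith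
    have h2 : 0 ≤ b - t := by linarith
    have : (b - a) * (α + β * t - γ * t ^ 2) = (t - a) * (α + β * b - γ * b ^ 2) +
        (b - t) * (α + β * a - γ * a ^ 2) + γ * ((t - a) * (b - t) * (b - a)) := by ring
    rw [this]
    positivity

/-- Here `r = |z|`, `t = |z - n|`, `ω = |z|² - n Re z`, so that `n² = t² + r² - 2 ω`. -/
theorem extremal_gap_nonneg {r t ω : ℝ} (hr : 0 ≤ r) (ht : 0 ≤ t) (hω : |ω| ≤ r * t)
    (hn : t ^ 2 + r ^ 2 - 2 * ω ≤ 1) (htr : t ≤ r + 1) :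
    0 ≤ (1 - r ^ 2) ^ 2 - t ^ 2 * (1 - r ^ 2) + 2 * t * |ω| - 2 * ω ^ 2 := by
  -- The expression is a concave quadratic in |ω|, so the ends of its range suffice. The upper end
  -- is rt; the lower end is 0, or (t² + r² - 1)/2 (forced by `hn`) when this is nonnegative.
  rw [← sq_abs ω]
  have hend : 0 ≤ ((1 - r ^ 2) ^ 2 - t ^ 2 * (1 - r ^ 2)) + 2 * t * (r * t) - 2 * (r * t) ^ 2 := by
    have : ((1 - r ^ 2) ^ 2 - t ^ 2 * (1 - r ^ 2)) + 2 * t * (r * t) - 2 * (r * t) ^ 2 =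
        (1 - r) ^ 2 * ((r + 1 - t) * (r + 1 + t)) := by ring
    rw [this]
    have : 0 ≤ r + 1 - t := by linarith
    positivity
  rcases le_total (t ^ 2) (1 - r ^ 2) with h | h
  · refine concave_quadratic_nonneg (a := 0) zero_le_two (abs_nonneg ω) hω ?_ hend
    have : 0 ≤ 1 - r ^ 2 := by nlinarith
    have : 0 ≤ (1 - r ^ 2) * (1 - r ^ 2 - t ^ 2) := mul_nonneg this (by linarith)
    linarith
  · have hle : (t ^ 2 - (1 - r ^ 2)) / 2 ≤ |ω| := (by linarith : _ ≤ ω).trans (le_abs_self ω)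
    refine concave_quadratic_nonneg (a := (t ^ 2 - (1 - r ^ 2)) / 2) zero_le_two hle hω ?_ hend
    have h1 : 1 ≤ t + r := by nlinarith
    have : (1 - r ^ 2) ^ 2 - t ^ 2 * (1 - r ^ 2) + 2 * t * ((t ^ 2 - (1 - r ^ 2)) / 2) -
        2 * ((t ^ 2 - (1 - r ^ 2)) / 2) ^ 2 =
        (t ^ 2 - (1 - r ^ 2)) * ((t + r - 1) * (r + 1 - t)) / 2 := by ring
    rw [this]
    have h2 : 0 ≤ t ^ 2 - (1 - r ^ 2) := by linarith
    have h3 : 0 ≤ t + r - 1 := by linarith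
    have h4 : 0 ≤ r + 1 - t := by linarith
    positivity

/-- The part of the determinant that does not involve `psiC`. -/
theorem det_main_part_nonneg {m n u θ Y : ℝ} (hmn : m ^ 2 ≤ n ^ 2) (hn : n ^ 2 ≤ 1) (hY : 0 ≤ Y) :
    0 ≤ m ^ 2 * (u ^ 2 + θ ^ 2 - n * u) ^ 2 +
      (n ^ 2 * (u ^ 2 + θ ^ 2 - 1) ^ 2 - m ^ 2 * ((u ^ 2 + θ ^ 2) ^ 2 -
        2 * n * u * (u ^ 2 + θ ^ 2) + (1 - n ^ 2) * (u ^ 2 + θ ^ 2) + 2 * n ^ 2 * u ^ 2 -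
        2 * n * u + n ^ 2)) * Y + m ^ 2 * ((u - n) ^ 2 + θ ^ 2) * Y ^ 2 := by
  set r := √(u ^ 2 + θ ^ 2)
  set t := √((u - n) ^ 2 + θ ^ 2)
  have hr : r ^ 2 = u ^ 2 + θ ^ 2 := Real.sq_sqrt (by positivity)
  have ht : t ^ 2 = (u - n) ^ 2 + θ ^ 2 := Real.sq_sqrt (by positivity)
  have hr0 : 0 ≤ r := Real.sqrt_nonneg _
  have ht0 : 0 ≤ t := Real.sqrt_nonneg _
  set ω := u ^ 2 + θ ^ 2 - n * u with hω
  have hωle : |ω| ≤ r * t := by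
    refine abs_le_of_sq_le_sq ?_ (by positivity)
    rw [mul_pow, hr, ht]
    nlinarith [sq_nonneg (n * θ)]
  have hnω : t ^ 2 + r ^ 2 - 2 * ω = n ^ 2 := by rw [hr, ht, hω]; ring
  have htr : t ≤ r + 1 := by
    have h1 : (t - r) ^ 2 ≤ 1 := by nlinarith [le_abs_self ω]
    linarith [(abs_le.1 ((sq_le_one_iff_abs_le_one _).1 h1)).2]
  have hgap := extremal_gap_nonneg hr0 ht0 hωle (hnω.trans_le hn) htr
  -- The quadratic in Y is m²(|ω| - tY)², plus m²Y times the gap of `extremal_gap_nonneg`, plus (n²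
  -- - m²)(1 - r²)²Y.
  have h1 : 0 ≤ ω ^ 2 + t ^ 2 * Y ^ 2 - 2 * |ω| * t * Y := by
    rw [← sq_abs ω]
    nlinarith [sq_nonneg (|ω| - t * Y)]
  have h2 : 0 ≤ m ^ 2 * ((ω ^ 2 + t ^ 2 * Y ^ 2 - 2 * |ω| * t * Y) + Y * ((1 - r ^ 2) ^ 2 -
      t ^ 2 * (1 - r ^ 2) + 2 * t * |ω| - 2 * ω ^ 2)) := by positivity
  have h3 : 0 ≤ (n ^ 2 - m ^ 2) * ((1 - r ^ 2) ^ 2 * Y) :=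
    mul_nonneg (by linarith) (by positivity)
  have key : m ^ 2 * ω ^ 2 +
      (n ^ 2 * (u ^ 2 + θ ^ 2 - 1) ^ 2 - m ^ 2 * ((u ^ 2 + θ ^ 2) ^ 2 -
        2 * n * u * (u ^ 2 + θ ^ 2) + (1 - n ^ 2) * (u ^ 2 + θ ^ 2) + 2 * n ^ 2 * u ^ 2 -
        2 * n * u + n ^ 2)) * Y + m ^ 2 * ((u - n) ^ 2 + θ ^ 2) * Y ^ 2 =
      m ^ 2 * ((ω ^ 2 + t ^ 2 * Y ^ 2 - 2 * |ω| * t * Y) + Y * ((1 - r ^ 2) ^ 2 -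
      t ^ 2 * (1 - r ^ 2) + 2 * t * |ω| - 2 * ω ^ 2)) +
      (n ^ 2 - m ^ 2) * ((1 - r ^ 2) ^ 2 * Y) := by
    rw [hr, ht, hω]
    ring
  rw [key]
  positivity

/-- The part of the determinant that involves `psiC`. -/
theorem det_imaginary_part_nonneg {m n s b c : ℝ} (hm : m ≠ 0) (hmn : m * n ≤ 0)
    (hle : m ^ 2 ≤ n ^ 2) (hs0 : 0 ≤ s) (hs : s ^ 2 = 1 - n ^ 2)
    (hb : b = -2 * m * n - m ^ 2 * n ^ 2 - n ^ 2) (hb0 : 0 ≤ b)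
    (hc : c = m * n * (s - 1 - m * n) / 2) :
    0 ≤ b ^ 2 * (m * n) ^ 2 - b * (m * n) ^ 2 * (m + n) ^ 2 +
      4 * c * (((m + n) * m + b) * ((m + n) * n + b) + (m + n) ^ 2 * (m * n) ^ 2) := by
  have hn : n ≠ 0 := by
    rintro rfl
    exact hm (by nlinarith [sq_nonneg m])
  obtain ⟨ρ, rfl⟩ : ∃ ρ, m = -ρ * n := ⟨-m / n, by field_simp⟩
  have hn2 : 0 < n ^ 2 := by positivity
  have hρ0 : 0 ≤ ρ := by nlinarith
  have hρ1 : ρ ≤ 1 := by nlinarith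
  have hs1 : s ≤ 1 := by nlinarith
  set A := 1 - ρ * n ^ 2 with hA
  have hbA : b = (s - A) * (s + A) := by rw [hb, hA]; linear_combination -hs
  have hA0 : 0 ≤ A := by nlinarith
  have hsA : A ≤ s := by
    by_contra hlt
    push Not at hlt
    nlinarith
  -- Both b and c contain the factor s - A with A = 1 + mn, and a square of it splits off. After m =
  -- -ρn only n² = 1 - s² occurs, so `gen` is a polynomial identity in ρ and s.
  have hfac : b ^ 2 * (-ρ * n * n) ^ 2 - b * (-ρ * n * n) ^ 2 * (-ρ * n + n) ^ 2 +
      4 * c * (((-ρ * n + n) * (-ρ * n) + b) * ((-ρ * n + n) * n + b) +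
        (-ρ * n + n) ^ 2 * (-ρ * n * n) ^ 2) =
      (-ρ * n * n) ^ 2 * (s - A) ^ 2 *
        (s * (2 * (s + A) * (1 - ρ * s) - ρ ^ 2 * n ^ 2 * s)) := by
    have gen : ∀ N : ℝ, N = 1 - s ^ 2 →
        ((s - (1 - ρ * N)) * (s + (1 - ρ * N))) ^ 2 * (ρ * N) ^ 2 -
          ((s - (1 - ρ * N)) * (s + (1 - ρ * N))) * (ρ * N) ^ 2 * ((1 - ρ) ^ 2 * N) -
          2 * ρ * N * (s - (1 - ρ * N)) *
            ((-(1 - ρ) * ρ * N + ((s - (1 - ρ * N)) * (s + (1 - ρ * N)))) *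
              ((1 - ρ) * N + ((s - (1 - ρ * N)) * (s + (1 - ρ * N)))) +
              (1 - ρ) ^ 2 * N * (ρ * N) ^ 2) =
        (ρ * N) ^ 2 * (s - (1 - ρ * N)) ^ 2 *
          (s * (2 * (s + (1 - ρ * N)) * (1 - ρ * s) - ρ ^ 2 * N * s)) := by
      rintro _ rfl
      ring
    have := gen (n ^ 2) (by linarith)
    rw [hc, hbA, hA]
    linear_combination this
  rw [hfac]
  -- Since ρ ≤ 1 and A ≥ 0, the expression is at least 2s(1-s) - n²s = s(1-s)².
  have h1 : 0 ≤ 2 * (s + A) * (1 - ρ * s) - ρ ^ 2 * n ^ 2 * s := by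
    have e0 : 0 ≤ 1 - s := sub_nonneg.2 hs1
    have e1 : ρ * s ≤ 1 * s := mul_le_mul_of_nonneg_right hρ1 hs0
    have e2 : ρ ^ 2 * (n ^ 2 * s) ≤ 1 * (n ^ 2 * s) :=
      mul_le_mul_of_nonneg_right (by nlinarith) (by positivity)
    have e3 : s * (1 - s) ≤ (s + A) * (1 - ρ * s) :=
      mul_le_mul (by linarith) (by linarith) e0 (by positivity)
    have e4 : n ^ 2 * s = s * (1 - s) * (1 + s) := by
      rw [show n ^ 2 = 1 - s ^ 2 by linarith]
      ring
    have e5 : 0 ≤ s * (1 - s) * (1 - s) := by positivity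
    linarith
  positivity

theorem psi_form_eq_hermitianForm (m n : ℝ) (z w : ℂ) (y : Fin 3 → ℂ) :
    (psi m n).form ![1, z, w] y =
      (((Complex.normSq (n * (1 + m * z)) + psiB m n * Complex.normSq z) * Complex.normSq (y 0) +
        (Complex.normSq (m * (n - z)) + psiB m n * Complex.normSq w) * Complex.normSq (y 1) +
        (((m + n) ^ 2 + psiB m n) * Complex.normSq w + psiB m n) * Complex.normSq (y 2) +
      2 * (star (y 0) * (-(n * m * (1 + m * z) * (n - star z)) + psiC m n * (star z - z)) * y 1).re +
      2 * (star (y 0) * (-((m + n) * (n * (1 + m * z)) + psiB m n) * star w) * y 2).re +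
      2 * (star (y 1) * (((m + n) * (m * (n - z)) - psiB m n * z) * star w) * y 2).re : ℝ) : ℂ) := by
  have hre : ∀ a : ℂ, ((2 * a.re : ℝ) : ℂ) = a + star a := fun a => (Complex.add_conj a).symm
  have hns : ∀ a : ℂ, ((Complex.normSq a : ℝ) : ℂ) = a * star a :=
    fun a => (Complex.mul_conj a).symm
  have hr : ∀ a : ℝ, star (a : ℂ) = a := fun a => Complex.conj_ofReal a
  rw [psi_form]
  rw [Complex.ofReal_add, Complex.ofReal_add, Complex.ofReal_add, hre, hre, hre]
  push_cast
  simp only [hns, star_one,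
    star_mul', star_add, star_sub, star_neg, star_star, hr]
  ring

/-- The relation `hc` cancels the (Im z)² term of the 2×2 minor, leaving b times a sum of
nonnegative terms that is strictly positive because w ≠ 0. -/
theorem psi_minor_pos {m n b c : ℝ} (hm : m ≠ 0) (hn : n ≠ 0) (hb : 0 < b)
    (hc : 4 * c * (m * n * (1 + m * n) + c) = b * (m * n) ^ 2) {z w : ℂ} (hw : w ≠ 0) :
    0 < (Complex.normSq (n * (1 + m * z)) + b * Complex.normSq z) ∧
    0 < (Complex.normSq (n * (1 + m * z)) + b * Complex.normSq z) *
      (Complex.normSq (m * (n - z)) + b * Complex.normSq w) -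
      Complex.normSq (-(n * m * (1 + m * z) * (n - star z)) + c * (star z - z)) := by
  have hz : 0 < Complex.normSq (n * (1 + m * z)) + b * Complex.normSq z := by
    have h1 := Complex.normSq_nonneg (n * (1 + m * z))
    rcases eq_or_ne z 0 with rfl | hz
    · have : (n * (1 + m * 0) : ℂ) ≠ 0 := by simpa using hn
      simpa using hn
    · have := mul_pos hb (Complex.normSq_pos.2 hz)
      linarith
  refine ⟨hz, ?_⟩
  have key : (Complex.normSq (n * (1 + m * z)) + b * Complex.normSq z) *
      (Complex.normSq (m * (n - z)) + b * Complex.normSq w) -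
      Complex.normSq (-(n * m * (1 + m * z) * (n - star z)) + c * (star z - z)) =
      b * (m ^ 2 * (Complex.normSq z - n * z.re) ^ 2 +
        Complex.normSq w * (Complex.normSq (n * (1 + m * z)) + b * Complex.normSq z)) := by
    simp only [Complex.normSq_apply, Complex.mul_re, Complex.mul_im, Complex.add_re,
      Complex.add_im, Complex.sub_re, Complex.sub_im, Complex.star_def, Complex.conj_re,
      Complex.conj_im, Complex.ofReal_re, Complex.ofReal_im, Complex.neg_re, Complex.neg_im,
      Complex.one_re, Complex.one_im]
    linear_combination (-z.im ^ 2) * hc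
  rw [key]
  have := mul_pos (Complex.normSq_pos.2 hw) hz
  positivity

/-- The relation `hc` removes c², so the determinant becomes affine in c, and c enters only through
a multiple of |w|²(Im z)². -/
theorem psi_det_eq {m n b c : ℝ} (hb : b = -2 * m * n - m ^ 2 * n ^ 2 - n ^ 2)
    (hc : 4 * c * (m * n * (1 + m * n) + c) = b * (m * n) ^ 2) {z w p q r : ℂ} {a d e : ℝ}
    (ha : a = Complex.normSq (n * (1 + m * z)) + b * Complex.normSq z)
    (hd : d = Complex.normSq (m * (n - z)) + b * Complex.normSq w)
    (he : e = ((m + n) ^ 2 + b) * Complex.normSq w + b)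
    (hp : p = -(n * m * (1 + m * z) * (n - star z)) + c * (star z - z))
    (hr : r = -((m + n) * (n * (1 + m * z)) + b) * star w)
    (hq : q = ((m + n) * (m * (n - z)) - b * z) * star w) :
    a * d * e + 2 * (p * q * star r).re - a * Complex.normSq q - d * Complex.normSq r -
      e * Complex.normSq p =
    b ^ 2 * (m ^ 2 * (z.re ^ 2 + z.im ^ 2 - n * z.re) ^ 2 +
      (n ^ 2 * (z.re ^ 2 + z.im ^ 2 - 1) ^ 2 - m ^ 2 * ((z.re ^ 2 + z.im ^ 2) ^ 2 -
        2 * n * z.re * (z.re ^ 2 + z.im ^ 2) + (1 - n ^ 2) * (z.re ^ 2 + z.im ^ 2) +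
        2 * n ^ 2 * z.re ^ 2 - 2 * n * z.re + n ^ 2)) * Complex.normSq w +
        m ^ 2 * ((z.re - n) ^ 2 + z.im ^ 2) * Complex.normSq w ^ 2) +
      Complex.normSq w * z.im ^ 2 * (b ^ 2 * (m * n) ^ 2 - b * (m * n) ^ 2 * (m + n) ^ 2 +
      4 * c * (((m + n) * m + b) * ((m + n) * n + b) + (m + n) ^ 2 * (m * n) ^ 2)) := by
  rw [ha, hd, he, hp, hq, hr]
  simp only [Complex.normSq_apply, Complex.mul_re, Complex.mul_im, Complex.add_re,
    Complex.add_im, Complex.sub_re, Complex.sub_im, Complex.star_def, Complex.conj_re,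
    Complex.conj_im, Complex.ofReal_re, Complex.ofReal_im, Complex.neg_re, Complex.neg_im,
    Complex.one_re, Complex.one_im]
  rw [hb] at hc ⊢
  linear_combination (-z.im ^ 2 *
    (((m + n) ^ 2 + (-2 * m * n - m ^ 2 * n ^ 2 - n ^ 2)) * (w.re * w.re + w.im * w.im) +
      (-2 * m * n - m ^ 2 * n ^ 2 - n ^ 2))) * hc

/-- Complex polarization in disguise: an identically vanishing form is positive semidefinite, so
every basis vector lies in its kernel. -/
theorem Matrix.eq_zero_of_sum_star_mul {ι : Type*} [Fintype ι] [DecidableEq ι] {B : ι → ι → ℂ}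
    (h : ∀ y : ι → ℂ, ∑ k, ∑ l, star (y k) * y l * B k l = 0) (k l : ι) : B k l = 0 := by
  have hform : ∀ y : ι → ℂ, star y ⬝ᵥ (of B) *ᵥ y = 0 := by
    intro y
    rw [← h y]
    simp only [dotProduct, mulVec, Finset.mul_sum, of_apply, Pi.star_apply]
    refine Finset.sum_congr rfl fun k _ => Finset.sum_congr rfl fun l _ => ?_
    ring
  have hB : (of B).PosSemidef := posSemidef_of_dotProduct_nonneg fun y => (hform y).ge
  simpa [Pi.single_apply] using (hB.sum_eq_zero (hform (Pi.single l 1))).1 k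

theorem QMap.form_smul {d₁ d₂ : ℕ} (Φ : QMap d₂ d₁) (a : ℂ) (x : Fin d₂ → ℂ) (y : Fin d₁ → ℂ) :
    Φ.form (a • x) y = Complex.normSq a * Φ.form x y := by
  have : vecMulVec (a • x) (star (a • x)) = (a * star a) • vecMulVec x (star x) := by
    rw [star_smul, smul_vecMulVec, vecMulVec_smul, smul_smul]
  rw [form, this, map_smul, smul_mulVec, dotProduct_smul, smul_eq_mul, form, ← Complex.mul_conj]
  rfl

theorem sqrt_param {m n : ℝ} (h : (m, n) ∈ doubleLeaf) (hle : m ^ 2 ≤ n ^ 2) :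
    √(1 - n ^ 2) ^ 2 = 1 - n ^ 2 ∧ 0 ≤ 1 + m * n ∧
      psiB m n = (√(1 - n ^ 2) - (1 + m * n)) * (√(1 - n ^ 2) + (1 + m * n)) := by
  have hn := sq_le_one_of_mem_doubleLeaf h
  have hs : √(1 - n ^ 2) ^ 2 = 1 - n ^ 2 := Real.sq_sqrt (by linarith)
  refine ⟨hs, ?_, ?_⟩
  · nlinarith [sq_nonneg (m + n)]
  · rw [psiB_of_sq_le hle]
    linear_combination -hs

theorem psiC_eq_zero {m n : ℝ} (h : (m, n) ∈ doubleLeaf) (hle : m ^ 2 ≤ n ^ 2)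
    (hb : psiB m n = 0) : psiC m n = 0 := by
  obtain ⟨-, hA, hfac⟩ := sqrt_param h hle
  have hs0 := Real.sqrt_nonneg (1 - n ^ 2)
  rw [hb] at hfac
  rw [psiC_of_sq_le hle (mul_nonpos_of_mem_doubleLeaf h)]
  -- If instead the other factor of b vanishes, both its summands are nonnegative and hence zero.
  have : √(1 - n ^ 2) - (1 + m * n) = 0 := by
    rcases mul_eq_zero.1 hfac.symm with h1 | h1 <;> linarith
  linear_combination m * n / 2 * this

theorem psi_form_nonneg_of_pos {m n : ℝ} (h : (m, n) ∈ doubleLeaf) (hle : m ^ 2 ≤ n ^ 2)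
    (hb : 0 < psiB m n) (x y : Fin 3 → ℂ) : 0 ≤ (psi m n).form x y := by
  have h0 : (m, n) ≠ (0, 0) := by
    rintro h0
    obtain ⟨rfl, rfl⟩ := Prod.mk.inj h0
    simp [psiB] at hb
  obtain ⟨hm, hn⟩ := doubleLeaf_ne_zero h h0
  obtain ⟨hs, -, -⟩ := sqrt_param h hle
  have hq := mul_nonpos_of_mem_doubleLeaf h
  have hn1 := sq_le_one_of_mem_doubleLeaf h
  have hbdef := psiB_of_sq_le hle
  have hcdef := psiC_of_sq_le hle hq
  have hc : 4 * psiC m n * (m * n * (1 + m * n) + psiC m n) = psiB m n * (m * n) ^ 2 := by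
    rw [hcdef, hbdef]
    linear_combination (m * n) ^ 2 * hs
  have h1 : ∀ z w : ℂ, w ≠ 0 → 0 ≤ (psi m n).form ![1, z, w] y := by
    intro z w hw
    rw [psi_form_eq_hermitianForm, Complex.zero_le_real]
    obtain ⟨ha, hmin⟩ := psi_minor_pos hm hn hb hc (z := z) hw
    refine hermitianForm_nonneg ha hmin ?_ _ _ _
    rw [psi_det_eq hbdef hc rfl rfl rfl rfl rfl rfl]
    have e1 := det_main_part_nonneg hle hn1 (Complex.normSq_nonneg w) (u := z.re) (θ := z.im)
    have e2 := det_imaginary_part_nonneg hm hq hle (Real.sqrt_nonneg _) hs hbdef hb.le hcdef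
    have e3 := Complex.normSq_nonneg w
    positivity
  have h2 : ∀ v : Fin 3 → ℂ, v 0 ≠ 0 → v 2 ≠ 0 → 0 ≤ (psi m n).form v y := by
    intro v hv0 hv2
    have hv : v = v 0 • ![1, v 1 / v 0, v 2 / v 0] := by
      ext i
      fin_cases i <;> simp [mul_div_cancel₀, hv0]
    rw [hv, QMap.form_smul]
    exact mul_nonneg (Complex.zero_le_real.2 (Complex.normSq_nonneg _))
      (h1 _ _ (div_ne_zero hv2 hv0))
  -- Perturbing along (1,0,1) makes the first and last coordinates nonzero; nonnegativity passes to
  -- the limit.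
  have hcont : Continuous fun ε : ℂ => (psi m n).form (x + ε • ![1, 0, 1]) y := by
    simp only [psi_form, Pi.add_apply, Pi.smul_apply]
    fun_prop
  have hlim : Filter.Tendsto (fun ε : ℂ => (psi m n).form (x + ε • ![1, 0, 1]) y)
      (nhdsWithin 0 {0}ᶜ) (nhds ((psi m n).form x y)) :=
    (hcont.tendsto' 0 _ (by simp)).mono_left nhdsWithin_le_nhds
  refine ge_of_tendsto hlim ?_
  have hne : ∀ a : ℂ, ∀ᶠ ε in nhdsWithin (0 : ℂ) {0}ᶜ, a + ε ≠ 0 := fun a => by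
    filter_upwards [nhdsNE_le_cofinite _ (Filter.eventually_cofinite_ne (-a))] with ε hε hzero
    exact hε (by linear_combination hzero)
  filter_upwards [hne (x 0), hne (x 2)] with ε h0 h2'
  exact h2 _ (by simpa using h0) (by simpa using h2')

/-- The matrix `V` with `psiBase z = V * z * Vᴴ`. -/
def psiKraus (m n : ℝ) : Matrix (Fin 3) (Fin 3) ℂ :=
  !![(n : ℂ), m * n, 0; -(m * n), m, 0; 0, 0, -(m + n)]

theorem psi_eq_kraus {m n : ℝ} (hb : psiB m n = 0) (hc : psiC m n = 0)
    (z : Matrix (Fin 3) (Fin 3) ℂ) :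
    psi m n z = psiKraus m n * z * (psiKraus m n)ᴴ := by
  rw [psi_apply, hb, hc]
  ext i j
  fin_cases i <;> fin_cases j <;>
    simp [psiBase, psiKraus, Matrix.mul_apply, vecMul, dotProduct, Fin.sum_univ_three] <;> ring

theorem psiC_eq_zero_of_psiB_eq_zero {m n : ℝ} (h : (m, n) ∈ doubleLeaf) (hb : psiB m n = 0) :
    psiC m n = 0 := by
  rcases le_total (m ^ 2) (n ^ 2) with hle | hle
  · exact psiC_eq_zero h hle hb
  · rw [psiC_comm]
    exact psiC_eq_zero (swap_mem_doubleLeaf h) hle (by rw [psiB_comm, hb])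

theorem QMap.isCompletelyPositive_of_kraus {d₁ d₂ : ℕ} {Φ : QMap d₂ d₁}
    {V : Matrix (Fin d₁) (Fin d₂) ℂ} (h : ∀ Z, Φ Z = V * Z * Vᴴ) : Φ.IsCompletelyPositive := by
  intro k Z hZ
  have key : Φ.ampliation k Z = (V ⊗ₖ (1 : Matrix (Fin k) (Fin k) ℂ)) * Z *
      (V ⊗ₖ (1 : Matrix (Fin k) (Fin k) ℂ))ᴴ := by
    ext ⟨a, p⟩ ⟨c, q⟩
    simp only [ampliation, of_apply, h, Matrix.mul_apply, Fintype.sum_prod_type,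
      conjTranspose_apply, kroneckerMap_apply, one_apply, Finset.sum_mul]
    simp [apply_ite, ite_mul]
  rw [key]
  exact hZ.mul_mul_conjTranspose_same _

theorem psi_isPositive_of_sq_le {m n : ℝ} (h : (m, n) ∈ doubleLeaf) (hle : m ^ 2 ≤ n ^ 2) :
    (psi m n).IsPositive := by
  rcases (psiB_nonneg h).eq_or_lt with hb | hb
  · intro Z hZ
    rw [psi_eq_kraus hb.symm (psiC_eq_zero h hle hb.symm)]
    exact hZ.mul_mul_conjTranspose_same _
  · rw [QMap.isPositive_iff_form_nonneg]
    exact psi_form_nonneg_of_pos h hle hb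

theorem psi_isPositive {m n : ℝ} (h : (m, n) ∈ doubleLeaf) : (psi m n).IsPositive := by
  rcases le_total (m ^ 2) (n ^ 2) with hle | hle
  · exact psi_isPositive_of_sq_le h hle
  · rw [← swapDual_psi]
    exact (psi_isPositive_of_sq_le (swap_mem_doubleLeaf h) hle).swapDual

/-! ### Extremality of `psi` -/

/-- At the two cusps `(1, -1)` and `(-1, 1)` the map has rank one. -/
theorem psi_isExtremePositive_of_cusp {n : ℝ} (hn : n ^ 2 = 1) (h : (-n, n) ∈ doubleLeaf) :
    (psi (-n) n).IsExtremePositive := by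
  have hb : psiB (-n) n = 0 := by
    rw [psiB_of_sq_le (by simp)]
    linear_combination (-n ^ 2) * hn
  have hc := psiC_eq_zero_of_psiB_eq_zero h hb
  have hn0 : n ≠ 0 := by
    rintro rfl
    norm_num at hn
  have hn' : (n : ℂ) ^ 2 = 1 := by exact_mod_cast hn
  -- The form is |x₀ - n x₁|² |n ȳ₀ + ȳ₁|², so it vanishes as soon as x or y lies in a fixed plane.
  have hform : ∀ x y : Fin 3 → ℂ, (x 0 - n * x 1) * (n * star (y 0) + star (y 1)) = 0 →
      (psi (-n) n).form x y = 0 := by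
    intro x y hxy
    have hL : (n * (x 0 + (-n : ℝ) * x 1) * star (y 0) - (-n : ℝ) * (n * x 0 - x 1) * star (y 1)
        - ((-n : ℝ) + n) * x 2 * star (y 2)) = (0 : ℂ) := by
      push_cast
      linear_combination hxy + (x 0 * star (y 1)) * hn'
    rw [psi_form, hL, hb, hc]
    simp
  refine QMap.isExtremePositive_of_nullAt (psi_isPositive h) (i₀ := 0) (k₀ := 0) ?_ ?_
  · rw [psi_tensor_zero]
    simpa using hn0
  · intro D hD hD0
    have hx2 : ∀ y, D.NullAt ![0, 0, 1] y := fun y => hD _ _ (hform _ _ (by simp))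
    have hx0 : ∀ y, D.NullAt ![n, 1, 0] y := fun y => hD _ _ (hform _ _ (by simp))
    have hy2 : ∀ x, D.NullAt x ![0, 0, 1] := fun x => hD _ _ (hform _ _ (by simp))
    have hy0 : ∀ x, D.NullAt x ![1, -n, 0] := fun x => hD _ _ (hform _ _ (by simp))
    have a1 : ∀ j k l, D.tensor 2 j k l = 0 := fun j =>
      Matrix.eq_zero_of_sum_star_mul fun y => by
        simpa [Fin.sum_univ_three] using (hx2 y).input_right j
    have a2 : ∀ i k l, D.tensor i 2 k l = 0 := fun i =>
      Matrix.eq_zero_of_sum_star_mul fun y => by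
        simpa [Fin.sum_univ_three] using (hx2 y).input_left i
    have a3 : ∀ j k l, n * D.tensor 0 j k l + D.tensor 1 j k l = 0 := fun j =>
      Matrix.eq_zero_of_sum_star_mul (B := fun k l => n * D.tensor 0 j k l + D.tensor 1 j k l)
      fun y => by
        have := (hx0 y).input_right j
        simp only [Fin.sum_univ_three, cons_val_zero, cons_val_one, cons_val_two, head_cons,
          tail_cons] at this ⊢
        linear_combination this
    have a4 : ∀ i k l, n * D.tensor i 0 k l + D.tensor i 1 k l = 0 := fun i =>
      Matrix.eq_zero_of_sum_star_mul (B := fun k l => n * D.tensor i 0 k l + D.tensor i 1 k l)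
      fun y => by
        have := (hx0 y).input_left i
        simp [Fin.sum_univ_three] at this ⊢
        linear_combination this
    have b1 : ∀ k j i, D.tensor i j k 2 = 0 := fun k =>
      Matrix.eq_zero_of_sum_star_mul (B := fun j i => D.tensor i j k 2) fun x => by
        have := (hy2 x).output_right k
        simp [Fin.sum_univ_three] at this ⊢
        linear_combination this
    have b2 : ∀ l j i, D.tensor i j 2 l = 0 := fun l =>
      Matrix.eq_zero_of_sum_star_mul (B := fun j i => D.tensor i j 2 l) fun x => by
        have := (hy2 x).output_left l
        simp [Fin.sum_univ_three] at this ⊢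
        linear_combination this
    have b3 : ∀ k j i, D.tensor i j k 0 - n * D.tensor i j k 1 = 0 := fun k =>
      Matrix.eq_zero_of_sum_star_mul (B := fun j i => D.tensor i j k 0 - n * D.tensor i j k 1)
      fun x => by
        have := (hy0 x).output_right k
        simp [Fin.sum_univ_three] at this ⊢
        linear_combination this
    have b4 : ∀ l j i, D.tensor i j 0 l - n * D.tensor i j 1 l = 0 := fun l =>
      Matrix.eq_zero_of_sum_star_mul (B := fun j i => D.tensor i j 0 l - n * D.tensor i j 1 l)
      fun x => by
        have := (hy0 x).output_left l
        simp [Fin.sum_univ_three] at this ⊢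
        linear_combination this
    have hnC : (n : ℂ) ≠ 0 := Complex.ofReal_ne_zero.2 hn0
    have c1 : ∀ i j k, D.tensor i j k 0 = 0 → ∀ l, D.tensor i j k l = 0 := by
      intro i j k h l
      have := b3 k j i
      rw [h, zero_sub, neg_eq_zero] at this
      fin_cases l
      exacts [h, (mul_eq_zero.1 this).resolve_left hnC, b1 k j i]
    have c2 : ∀ i j, D.tensor i j 0 0 = 0 → ∀ k, D.tensor i j k 0 = 0 := by
      intro i j h k
      have := b4 0 j i
      rw [h, zero_sub, neg_eq_zero] at this
      fin_cases k
      exacts [h, (mul_eq_zero.1 this).resolve_left hnC, b2 0 j i]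
    have c3 : ∀ i, D.tensor i 0 0 0 = 0 → ∀ j, D.tensor i j 0 0 = 0 := by
      intro i h j
      have := a4 i 0 0
      rw [h, mul_zero, zero_add] at this
      fin_cases j
      exacts [h, this, a2 i 0 0]
    have c4 : ∀ i, D.tensor i 0 0 0 = 0 := by
      intro i
      have := a3 0 0 0
      rw [hD0, mul_zero, zero_add] at this
      fin_cases i
      exacts [hD0, this, a1 0 0 0]
    exact QMap.ext_tensor fun i j k l => c1 i j k (c2 i j (c3 i (c4 i) j) k) l

theorem psi_isExtremePositive_of_sq_le {m n : ℝ} (h : (m, n) ∈ doubleLeaf)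
    (h0 : (m, n) ≠ (0, 0)) (hle : m ^ 2 ≤ n ^ 2) : (psi m n).IsExtremePositive := by
  obtain ⟨hm, hn⟩ := doubleLeaf_ne_zero h h0
  have hq := mul_nonpos_of_mem_doubleLeaf h
  have hn1 := sq_le_one_of_mem_doubleLeaf h
  -- If n² = 1, the leaf inequality reads -(m+n)² ≥ 0: only the cusps remain.
  rcases hn1.eq_or_lt with hn1' | hn1'
  · obtain rfl : m = -n := by
      have := h.2.2.1
      simp only [hn1'] at this
      nlinarith [sq_nonneg (m + n)]
    exact psi_isExtremePositive_of_cusp hn1' h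
  · refine QMap.isExtremePositive_of_nullAt (psi_isPositive h) (i₀ := 0) (k₀ := 0) ?_ ?_
    · rw [psi_tensor_zero]
      simpa using hn
    · intro D hD hD0
      have hs : √(1 - n ^ 2) ≠ 0 := (Real.sqrt_pos.2 (by linarith)).ne'
      have hmn : m ≠ n := by
        rintro rfl
        have := mul_self_pos.2 hm
        linarith
      exact QMap.eq_zero_of_nullAt hm hn hs hmn (by linarith : m ^ 2 < 1).ne
        (hD _ _ (psi_form_basis_one_two m n)) (hD _ _ (psi_form_basis_two_zero m n))
        (fun e w he hw => hD _ _ (psi_form_circle m n he hw))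
        (fun g => hD _ _ (psi_form_curve hle hq hn1 g)) hD0

theorem psi_isExtremePositive {m n : ℝ} (h : (m, n) ∈ doubleLeaf) (h0 : (m, n) ≠ (0, 0)) :
    (psi m n).IsExtremePositive := by
  rcases le_total (m ^ 2) (n ^ 2) with hle | hle
  · exact psi_isExtremePositive_of_sq_le h h0 hle
  · rw [← swapDual_psi]
    refine (psi_isExtremePositive_of_sq_le (swap_mem_doubleLeaf h) (fun he => h0 ?_) hle).swapDual
    obtain ⟨rfl, rfl⟩ := Prod.mk.inj he
    rfl

/-! ### Complete and co-complete positivity via the Choi form -/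

theorem QMap.IsCompletelyPositive.choi_nonneg {d₁ d₂ : ℕ} {Φ : QMap d₂ d₁}
    (h : Φ.IsCompletelyPositive) (ξ : Fin d₁ → Fin d₂ → ℂ) :
    0 ≤ ∑ k, ∑ i, ∑ l, ∑ j, star (ξ k i) * ξ l j * Φ.tensor i j k l := by
  -- The unnormalized maximally entangled vector, whose image under Φ ⊗ Id is the Choi matrix.
  let v : Fin d₂ × Fin d₂ → ℂ := fun p => if p.1 = p.2 then 1 else 0
  have hZ := h d₂ _ (posSemidef_vecMulVec_self_star v)
  have := hZ.dotProduct_mulVec_nonneg (fun p => ξ p.1 p.2)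
  convert this using 1
  simp only [dotProduct, mulVec, Fintype.sum_prod_type, Finset.mul_sum]
  refine Finset.sum_congr rfl fun k _ => Finset.sum_congr rfl fun i _ =>
    Finset.sum_congr rfl fun l _ => Finset.sum_congr rfl fun j _ => ?_
  have hE : (of fun a c => vecMulVec v (star v) (a, i) (c, j)) = single i j (1 : ℂ) := by
    ext a c
    simp [v, vecMulVec_apply, single_apply]
    grind
  simp only [ampliation, of_apply, hE, tensor, Pi.star_apply]
  ring

theorem QMap.tensor_transposeComp {d₁ d₂ : ℕ} (Φ : QMap d₂ d₁) (i j : Fin d₂) (k l : Fin d₁) :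
    Φ.transposeComp.tensor i j k l = Φ.tensor i j l k := rfl

theorem not_isCompletelyPositive_psi {m n : ℝ} (hn : n ≠ 0) (hb : 0 < psiB m n) :
    ¬ (psi m n).IsCompletelyPositive := by
  intro h
  -- The test vector is orthogonal to `psiKraus`, so the base part contributes n² + mn - n(m+n) = 0
  -- and only the b-term survives.
  have h1 := h.choi_nonneg (fun k i => ((!![n, 0, 0; -1, 0, 0; 0, 0, n] k i : ℝ) : ℂ))
  have h2 : ∑ k, ∑ i, ∑ l, ∑ j, star ((!![n, 0, 0; -1, 0, 0; 0, 0, n] k i : ℝ) : ℂ) *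
      ((!![n, 0, 0; -1, 0, 0; 0, 0, n] l j : ℝ) : ℂ) * (psi m n).tensor i j k l =
      ((-(psiB m n * n ^ 2) : ℝ) : ℂ) := by
    simp [Fin.sum_univ_three, QMap.tensor, psi_apply, psiBase, psiChoi, psiAnti]
    ring
  rw [h2, Complex.zero_le_real] at h1
  have : 0 < psiB m n * n ^ 2 := by positivity
  linarith

/-- With u = n(m+n) + b, the Choi matrix of T ∘ Ψ has a principal block [[0, -u], [-u, b]], which is
indefinite for u ≠ 0; the test vector has entries b and u. -/
theorem not_isCoCompletelyPositive_psi_of_left {m n : ℝ} (hb : 0 < psiB m n)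
    (h0 : n * (m + n) + psiB m n ≠ 0) : ¬ (psi m n).IsCoCompletelyPositive := by
  intro h
  have h1 := QMap.IsCompletelyPositive.choi_nonneg h (fun k i => ((!![0, 0, psiB m n; 0, 0, 0;
    n * (m + n) + psiB m n, 0, 0] k i : ℝ) : ℂ))
  have h2 : ∑ k, ∑ i, ∑ l, ∑ j, star ((!![0, 0, psiB m n; 0, 0, 0;
      n * (m + n) + psiB m n, 0, 0] k i : ℝ) : ℂ) * ((!![0, 0, psiB m n; 0, 0, 0;
      n * (m + n) + psiB m n, 0, 0] l j : ℝ) : ℂ) * (psi m n).transposeComp.tensor i j k l =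
      ((-(psiB m n * (n * (m + n) + psiB m n) ^ 2) : ℝ) : ℂ) := by
    simp only [QMap.tensor_transposeComp]
    simp [Fin.sum_univ_three, QMap.tensor, psi_apply, psiBase, psiChoi, psiAnti]
    ring
  rw [h2, Complex.zero_le_real] at h1
  have : 0 < psiB m n * (n * (m + n) + psiB m n) ^ 2 := by positivity
  linarith

theorem not_isCoCompletelyPositive_psi_of_right {m n : ℝ} (hb : 0 < psiB m n)
    (h0 : m * (m + n) + psiB m n ≠ 0) : ¬ (psi m n).IsCoCompletelyPositive := by
  intro h
  have h1 := QMap.IsCompletelyPositive.choi_nonneg h (fun k i => ((!![0, 0, 0;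
    0, 0, m * (m + n) + psiB m n; 0, psiB m n, 0] k i : ℝ) : ℂ))
  have h2 : ∑ k, ∑ i, ∑ l, ∑ j, star ((!![0, 0, 0;
      0, 0, m * (m + n) + psiB m n; 0, psiB m n, 0] k i : ℝ) : ℂ) * ((!![0, 0, 0;
      0, 0, m * (m + n) + psiB m n; 0, psiB m n, 0] l j : ℝ) : ℂ) *
        (psi m n).transposeComp.tensor i j k l =
      ((-(psiB m n * (m * (m + n) + psiB m n) ^ 2) : ℝ) : ℂ) := by
    simp only [QMap.tensor_transposeComp]
    simp [Fin.sum_univ_three, QMap.tensor, psi_apply, psiBase, psiChoi, psiAnti]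
    ring
  rw [h2, Complex.zero_le_real] at h1
  have : 0 < psiB m n * (m * (m + n) + psiB m n) ^ 2 := by positivity
  linarith

theorem not_isCoCompletelyPositive_psi {m n : ℝ} (h : (m, n) ∈ doubleLeaf)
    (hb : 0 < psiB m n) : ¬ (psi m n).IsCoCompletelyPositive := by
  have key : ∀ {a c : ℝ}, (a, c) ∈ doubleLeaf → a ^ 2 ≤ c ^ 2 → 0 < psiB a c →
      c * (a + c) + psiB a c ≠ 0 := by
    intro a c hac hle hpos h0
    have hc := sq_le_one_of_mem_doubleLeaf hac
    rw [psiB_of_sq_le hle] at h0 hpos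
    -- Inserting b gives c(a+c) + b = -ac(1+ac), and b > 0 excludes both ac = 0 and ac = -1.
    have h1 : a * c * (1 + a * c) = 0 := by linear_combination -h0
    rcases mul_eq_zero.1 h1 with h2 | h2
    · nlinarith [sq_nonneg c, sq_nonneg (a * c)]
    · have h3 : a * c = -1 := by linarith
      nlinarith [mul_le_mul_of_nonneg_right hle (sq_nonneg c), sq_nonneg c]
  rcases le_total (m ^ 2) (n ^ 2) with hle | hle
  · exact not_isCoCompletelyPositive_psi_of_left hb (key h hle hb)
  · refine not_isCoCompletelyPositive_psi_of_right hb ?_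
    have := key (swap_mem_doubleLeaf h) hle (by rwa [psiB_comm])
    rwa [psiB_comm, add_comm n m] at this

theorem psi_zero_zero : psi 0 0 = 0 := by
  ext1 z
  rw [psi_apply]
  ext i j
  fin_cases i <;> fin_cases j <;> simp [psiBase, psiB, psiC]

theorem psi_hasKrausRank_one {m n : ℝ} (h : (m, n) ∈ doubleLeaf) (h0 : (m, n) ≠ (0, 0))
    (hb : psiB m n = 0) : (psi m n).HasKrausRank 1 := by
  refine ⟨⟨fun _ => psiKraus m n, fun Z => ?_⟩, ?_⟩
  · simpa using psi_eq_kraus hb (psiC_eq_zero_of_psiB_eq_zero h hb) Z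
  · rintro K ⟨A, hA⟩
    rw [Nat.one_le_iff_ne_zero]
    rintro rfl
    exact (psi_isExtremePositive h h0).2.1 (LinearMap.ext fun Z => by simp [hA])

theorem theorem3p3 (m n : ℝ) (hmn : (m, n) ∈ doubleLeaf) :
    (psi m n).IsPositive ∧
    ((m, n) = (0, 0) → psi m n = 0) ∧
    ((m, n) ≠ (0, 0) → (psi m n).IsExtremePositive) ∧
    ((m, n) ∉ frontier doubleLeaf →
      ¬ (psi m n).IsCompletelyPositive ∧ ¬ (psi m n).IsCoCompletelyPositive) ∧
    ((m, n) ∈ frontier doubleLeaf →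
      (psi m n).IsCompletelyPositive ∧ ((m, n) ≠ (0, 0) → (psi m n).HasKrausRank 1)) := by
  refine ⟨psi_isPositive hmn, ?_, psi_isExtremePositive hmn, ?_, ?_⟩
  · intro h
    obtain ⟨rfl, rfl⟩ := Prod.mk.inj h
    exact psi_zero_zero
  · rw [mem_frontier_doubleLeaf_iff hmn]
    intro hb
    have hpos : 0 < psiB m n := lt_of_le_of_ne (psiB_nonneg hmn) (Ne.symm hb)
    have hn : n ≠ 0 := by
      rintro rfl
      have := (min_le_right _ _).trans_lt' hpos
      nlinarith [sq_nonneg m]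
    exact ⟨not_isCompletelyPositive_psi hn hpos, not_isCoCompletelyPositive_psi hmn hpos⟩
  · rw [mem_frontier_doubleLeaf_iff hmn]
    intro hb
    exact ⟨QMap.isCompletelyPositive_of_kraus
      (psi_eq_kraus hb (psiC_eq_zero_of_psiB_eq_zero hmn hb)),
      fun h0 => psi_hasKrausRank_one hmn h0 hb⟩
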